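/- **Theorem.** The model-checking problem for RB±ATL is decidable: there is an algorithm which, given (an explicit finite description of) a finite resource-bounded concurrent game structure $M$, a state $s$ of $M$ and an RB±ATL formula $\varphi$ over the agents, resources and propositions of $M$, decides whether $M,s\models\varphi$. Here a *resource-bounded concurrent game structure* (RB-CGS) is a tuple $M=(Agt,Res,S,\Pi,\pi,Act,d,c,\delta)$, in which $Agt$, $Res$, $S$ are non-empty finite sets (of agents, resources, states), $\Pi$ is a finite set of propositions, $\pi:\Pi\to\wp(S)$, $Act$ is a finite set of actions containing an action $idle$, and - $d(s,a)\subseteq Act$ is the set of actions available to agent $a$ in state $s$, with $idle\in d(s,a)$ for all $s,a$; - $c(s,a,\alpha)\in\mathbb Z^{Res}$ is defined for $\alpha\in d(s,a)$ (positive entries are consumption, negative entries production), and $c(s,a,idle)=\bar 0$; - $\delta(s,\sigma)\in S$ is defined for $\sigma\in D(s)=\prod_{a\in Agt}d(s,a)$. *Formulas* are given by $\varphi,\psi::=p\mid\neg\varphi\mid\varphi\lor\psi\mid\langle\!\langle A^b\rangle\!\rangle\bigcirc\varphi\mid\langle\!\langle A^b\rangle\!\rangle\Box\varphi\mid\langle\!\langle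 A^b\rangle\!\rangle\varphi\,\mathcal U\,\psi$ with $p\in\Pi$, $A\subseteq Agt$ and $b\in(\mathbb N\cup\{\infty\})^{Res}$. For $A\subseteq Agt$ let $D_A(s)=\prod_{a\in A}d(s,a)$. For $\sigma\in D_A(s)$ let $out(s,\sigma)=\{\delta(s,\sigma')\mid\sigma'\in D(s),\ \sigma'_a=\sigma_a\text{ for all }a\in A\}$ and $cost_A(s,\sigma)=\sum_{a\in A}c(s,a,\sigma_a)$. A *strategy* $F$ for $A$ assigns to each non-empty finite sequence of states $\lambda s\in S^+$ a joint action $F(\lambda s)\in D_A(s)$. Let $out(s,F)$ be the set of all $\lambda\in S^\omega$ with $\lambda[0]=s$ and $\lambda[i+1]\in out(\lambda[i],F(\lambda[0,i]))$ for all $i\ge 0$. Call $F$ a *$b$-strategy* if for every state $s$, every $\lambda\in out(s,F)$ and every $i\ge 0$, $\sum_{j=0}^{i}cost_A(\lambda[j],F(\lambda[0,j]))\le b$ componentwise. *Truth*: $M,s\models p$ iff $s\in\pi(p)$; $\neg$ and $\lor$ are interpreted as usual; and - $M,s\models\langle\!\langle A^b\rangle\!\rangle\bigcirc\varphi$ iff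 there is a $b$-strategy $F$ for $A$ with $M,\lambda[1]\models\varphi$ for all $\lambda\in out(s,F)$; - $M,s\models\langle\!\langle A^b\rangle\!\rangle\Box\varphi$ iff there is a $b$-strategy $F$ for $A$ with $M,\lambda[i]\models\varphi$ for all $\lambda\in out(s,F)$ and all $i\ge0$; - $M,s\models\langle\!\langle A^b\rangle\!\rangle\varphi\,\mathcal U\,\psi$ iff there is a $b$-strategy $F$ for $A$ such that for all $\lambda\in out(s,F)$ there is $i\ge0$ with $M,\lambda[i]\models\psi$ and $M,\lambda[j]\models\varphi$ for all $0\le j<i$. -/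

import Mathlib

namespace RBATL

/-- Formulas of the logic over agents `Agt`, resources `Res` and propositions `Prp`.
A resource bound is a vector `b : Res → ℕ∞`, where `⊤` is the infinite bound. -/
inductive Formula (Agt Res Prp : Type*) where
  | atom (p : Prp)
  | neg (φ : Formula Agt Res Prp)
  | disj (φ ψ : Formula Agt Res Prp)
  /-- `⟨⟨A^b⟩⟩ ○ φ` -/
  | coalNext (A : Finset Agt) (b : Res → ℕ∞) (φ : Formula Agt Res Prp)
  /-- `⟨⟨A^b⟩⟩ □ φ` -/
  | coalBox (A : Finset Agt) (b : Res → ℕ∞) (φ : Formula Agt Res Prp)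
  /-- `⟨⟨A^b⟩⟩ φ U ψ` -/
  | coalUntil (A : Finset Agt) (b : Res → ℕ∞) (φ ψ : Formula Agt Res Prp)

/-- Resource-bounded concurrent game structures. The partial functions for costs and transitions
are functions on their domains of definition: costs are given for the available actions only,
transitions for the available joint actions only. A positive cost is consumption, a negative cost
is production. -/
structure RBCGS (Agt Res S Prp Act : Type*) where
  agt_nonempty : Nonempty Agt
  res_nonempty : Nonempty Res
  state_nonempty : Nonempty S
  /-- the states where a proposition is true -/
  val : Prp → Set S
  idle : Act
  /-- the actions available to an agent in a state -/
  avail : S → Agt → Set Act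
  idle_mem : ∀ s a, idle ∈ avail s a
  cost : (s : S) → (a : Agt) → avail s a → Res → ℤ
  cost_idle : ∀ s a, cost s a ⟨idle, idle_mem s a⟩ = 0
  trans : (s : S) → ((a : Agt) → avail s a) → S

namespace RBCGS

variable {Agt Res S Prp Act : Type*} (M : RBCGS Agt Res S Prp Act)

/-- Joint actions of the coalition `A` that are available at `s`. -/
abbrev JointAction (A : Finset Agt) (s : S) : Type _ := (a : A) → M.avail s a

/-- The possible outcomes at `s` of a joint action of the coalition `A`. -/
def outcomes {A : Finset Agt} (s : S) (σ : M.JointAction A s) : Set S :=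
  {t | ∃ τ : (a : Agt) → M.avail s a, (∀ a : A, τ a = σ a) ∧ t = M.trans s τ}

/-- The cost of a joint action of the coalition `A`, as a vector of integers. -/
def jointCost {A : Finset Agt} (s : S) (σ : M.JointAction A s) : Res → ℤ :=
  ∑ a : A, M.cost s a (σ a)

/-- A (perfect recall) strategy for `A`: to every non-empty finite sequence `h ++ [s]` of states it
assigns a joint action of `A` that is available at the last state `s`. -/
abbrev Strategy (A : Finset Agt) : Type _ := (h : List S) → (s : S) → M.JointAction A s

variable {M}

/-- The joint action chosen by the strategy `F` after the prefix `w 0, …, w i` of the infinite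
sequence of states `w`. -/
def Strategy.choice {A : Finset Agt} (F : M.Strategy A) (w : ℕ → S) (i : ℕ) :
    M.JointAction A (w i) :=
  F ((List.range i).map w) (w i)

/-- The infinite computations from `s` that are consistent with `F`. -/
def Strategy.out {A : Finset Agt} (F : M.Strategy A) (s : S) : Set (ℕ → S) :=
  {w | w 0 = s ∧ ∀ i, w (i + 1) ∈ M.outcomes (w i) (F.choice w i)}

/-- The computations from `s` that are `b`-consistent with `F`: in addition, the accumulated cost
of every prefix is at most `b` (a component `⊤` of `b` imposes no constraint). -/
def Strategy.outBounded {A : Finset Agt} (F : M.Strategy A) (s : S) (b : Res → ℕ∞) :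
    Set (ℕ → S) :=
  {w | w ∈ F.out s ∧ ∀ (i : ℕ) (ρ : Res) (n : ℕ), b ρ = (n : ℕ∞) →
    ∑ j ∈ Finset.range (i + 1), M.jointCost (w j) (F.choice w j) ρ ≤ (n : ℤ)}

/-- `F` is a `b`-strategy. -/
def Strategy.IsBounded {A : Finset Agt} (F : M.Strategy A) (b : Res → ℕ∞) : Prop :=
  ∀ s, F.out s = F.outBounded s b

variable (M)

/-- Truth of a formula in a state. -/
def Sat : Formula Agt Res Prp → S → Prop
  | .atom p, s => s ∈ M.val p
  | .neg φ, s => ¬ Sat φ s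
  | .disj φ ψ, s => Sat φ s ∨ Sat ψ s
  | .coalNext A b φ, s => ∃ F : M.Strategy A, F.IsBounded b ∧ ∀ w ∈ F.out s, Sat φ (w 1)
  | .coalBox A b φ, s => ∃ F : M.Strategy A, F.IsBounded b ∧ ∀ w ∈ F.out s, ∀ i, Sat φ (w i)
  | .coalUntil A b φ ψ, s => ∃ F : M.Strategy A, F.IsBounded b ∧
      ∀ w ∈ F.out s, ∃ i, Sat ψ (w i) ∧ ∀ j < i, Sat φ (w j)

end RBCGS

/-- An instance of the model-checking problem: a finite structure, a state and a formula. The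
finite sets of agents, resources, states, propositions and actions are initial segments of `ℕ`. -/
structure Instance where
  numAgt : ℕ
  numRes : ℕ
  numState : ℕ
  numPrp : ℕ
  numAct : ℕ
  model : RBCGS (Fin numAgt) (Fin numRes) (Fin numState) (Fin numPrp) (Fin numAct)
  state : Fin numState
  formula : Formula (Fin numAgt) (Fin numRes) (Fin numPrp)

/-- The question asked by an instance. -/
def Instance.Holds (I : Instance) : Prop := I.model.Sat I.formula I.state

/-! ### Instances as finite data -/

/-- A symbol in the prefix (Polish) notation of a formula: a number for the kind of the symbol,
the proposition or the list of members of the coalition, and the list of components of the bound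
(`none` for an infinite one). -/
abbrev Token : Type := ℕ × List ℕ × List (Option ℕ)

/-- The elements of a coalition in increasing order. -/
def coalitionCode {n : ℕ} (A : Finset (Fin n)) : List ℕ :=
  ((List.finRange n).filter (fun a => a ∈ A)).map (fun a => (a : ℕ))

/-- The components of a bound in order. -/
def boundCode {r : ℕ} (b : Fin r → ℕ∞) : List (Option ℕ) :=
  List.ofFn fun i => if b i = ⊤ then none else some (b i).toNat

/-- The prefix notation of a formula. -/
def Formula.code {n r k : ℕ} : Formula (Fin n) (Fin r) (Fin k) → List Token
  | .atom p => [(0, [(p : ℕ)], [])]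
  | .neg φ => (1, [], []) :: φ.code
  | .disj φ ψ => (2, [], []) :: (φ.code ++ ψ.code)
  | .coalNext A b φ => (3, coalitionCode A, boundCode b) :: φ.code
  | .coalBox A b φ => (4, coalitionCode A, boundCode b) :: φ.code
  | .coalUntil A b φ ψ => (5, coalitionCode A, boundCode b) :: (φ.code ++ ψ.code)

section ModelCode

variable {n r m k l : ℕ} (M : RBCGS (Fin n) (Fin r) (Fin m) (Fin k) (Fin l))

open Classical in
/-- The pairs `(p, s)` such that the proposition `p` is true in the state `s`. -/
noncomputable def valCode : List (ℕ × ℕ) :=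
  (List.finRange k).flatMap fun p => (List.finRange m).filterMap fun s =>
    if s ∈ M.val p then some ((p : ℕ), (s : ℕ)) else none

open Classical in
/-- The tuples `(s, a, α, c)` such that the action `α` is available to the agent `a` in the state
`s`, with cost vector `c`. An integer cost `z` is written as the pair of the amount
`max z 0` consumed and the amount `max (-z) 0` produced. -/
noncomputable def costCode : List (ℕ × ℕ × ℕ × List (ℕ × ℕ)) :=
  (List.finRange m).flatMap fun s => (List.finRange n).flatMap fun a =>
    (List.finRange l).filterMap fun α =>
      if h : α ∈ M.avail s a then
        some ((s : ℕ), (a : ℕ), (α : ℕ),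
          List.ofFn fun i => ((M.cost s a ⟨α, h⟩ i).toNat, (-(M.cost s a ⟨α, h⟩ i)).toNat))
      else none

open Classical in
/-- The tuples `(s, σ, t)` such that the joint action `σ` of all agents is available in the state
`s` and leads to the state `t`; `σ` is written as the list of its components. -/
noncomputable def transCode : List (ℕ × List ℕ × ℕ) :=
  (List.finRange m).flatMap fun s => (List.finRange (l ^ n)).filterMap fun j =>
    let σ : Fin n → Fin l := finFunctionFinEquiv.symm j
    if h : ∀ a, σ a ∈ M.avail s a then
      some ((s : ℕ), List.ofFn (fun a => (σ a : ℕ)), (M.trans s (fun a => ⟨σ a, h a⟩) : ℕ))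
    else none

end ModelCode

/-- Inputs of the decision procedure: the numbers of agents, resources, states, propositions and
actions; the truth assignment; the idle action; the available actions with their costs; the
transitions; the state; the formula. -/
abbrev Code : Type :=
  (ℕ × ℕ × ℕ × ℕ × ℕ) × List (ℕ × ℕ) × ℕ × List (ℕ × ℕ × ℕ × List (ℕ × ℕ)) ×
    List (ℕ × List ℕ × ℕ) × ℕ × List Token

/-- An instance written out as finite data. -/
noncomputable def Instance.code (I : Instance) : Code :=
  ((I.numAgt, I.numRes, I.numState, I.numPrp, I.numAct), valCode I.model, (I.model.idle : ℕ),
    costCode I.model, transCode I.model, (I.state : ℕ), I.formula.code)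

end RBATL

/-!
# Decidability of model checking for RB±ATL

A modality `⟨⟨A^b⟩⟩` asks for the winner of a game between the coalition `A` and the other agents,
played on pairs of a state and a remaining budget in `ℕ∞ ^ Res`. A strategy may depend on the whole
history, but the remaining budget is all it needs to remember: the coalition can recompute the
budget from the history, and it idles at no cost wherever it has nothing to win, so that the bound
is kept from every state. Truth of `⟨⟨A^b⟩⟩ □ φ` and of `⟨⟨A^b⟩⟩ φ U ψ` thus becomes a safety game
and a reachability game on an infinite graph with finitely many moves.

In both games each player, if winning, has a finite proof of it.

* Safety, coalition wins: the winning budgets of a state form an upward closed set, which has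
  finitely many minimal elements because `ℕ∞ ^ Res` is well-quasi-ordered. The minimal positions
  are a finite set that the coalition can stay above (`exists_boxClosed_or_boxRefuted`).
* Safety, opponents win: they win within a bounded number of rounds, which a finite ranked set of
  positions shows (the same lemma).
* Reachability, coalition wins: again a finite ranked set of positions
  (`exists_untilRanked_or_untilTrap`).
* Reachability, opponents win: the losing budgets form a downward closed set. Adding the vectors
  with infinite components all of whose finite approximations are losing makes it closed under
  suprema of chains, so every element lies below a maximal one; the maximal elements form an
  antichain and are finite in number. They are a trap for the coalition (the same lemma).

Whether a finite list of positions is such a proof is a primitive recursive question, since it only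
quantifies over members of lists. Searching for a proof for either player therefore always
terminates (`exists_computable_of_certificates`), even for games that come from no structure. A
formula is evaluated from right to left in its prefix notation on a stack of truth sets
(`evaluate_code_append`).
-/

namespace RBATL

/-! ### Energy games -/

/-- A move of the protagonist of an energy game on the states `S`: it is available at `src`, it
costs `cost`, and the antagonist chooses the next state in `out`. -/
@[ext] structure Move (S ι : Type*) where
  src : S
  cost : ι → ℤ
  out : Set S

section Payment

variable {ι : Type*}

/-- The budget `e` covers the cost `c`. -/
def Payable (c : ι → ℤ) (e : ι → ℕ∞) : Prop :=
  ∀ i, ∀ n : ℕ, e i = n → c i ≤ n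

/-- What is left of the budget `e` after paying `c`, truncated at `0` when `e` does not
cover `c`. -/
def rest (c : ι → ℤ) (e : ι → ℕ∞) : ι → ℕ∞ :=
  fun i => e i + ((-(c i)).toNat : ℕ∞) - ((c i).toNat : ℕ∞)

theorem rest_apply_top {c : ι → ℤ} {e : ι → ℕ∞} {i : ι} (h : e i = ⊤) : rest c e i = ⊤ := by
  simp [rest, h]

theorem rest_apply_nat {c : ι → ℤ} {e : ι → ℕ∞} {i : ι} {n : ℕ} (h : e i = n) :
    rest c e i = ((n - c i).toNat : ℕ) := by
  simp only [rest, h]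
  norm_cast
  omega

theorem Payable.mono {c : ι → ℤ} {e e' : ι → ℕ∞} (h : Payable c e) (hle : e ≤ e') :
    Payable c e' := by
  intro i n hn
  have h1 : e i ≤ n := hn ▸ hle i
  obtain ⟨k, hk⟩ := ENat.ne_top_iff_exists.1 (ne_top_of_le_ne_top (ENat.natCast_ne_top n) h1)
  have := h i k hk.symm
  rw [← hk] at h1
  norm_cast at h1
  omega

theorem rest_mono {c : ι → ℤ} {e e' : ι → ℕ∞} (hle : e ≤ e') : rest c e ≤ rest c e' :=
  fun i => tsub_le_tsub_right (add_le_add_left (hle i) _) _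

/-- With the cost written as a difference of natural numbers, covering the cost and keeping at
least `e'` is one inequality without subtraction. -/
theorem add_le_add_iff_rest {c : ι → ℤ} {e e' : ι → ℕ∞} {p q : ι → ℕ}
    (h : ∀ i, c i = p i - q i) :
    (∀ i, e' i + p i ≤ e i + q i) ↔ Payable c e ∧ e' ≤ rest c e := by
  constructor
  · intro H
    have key : ∀ i, ∀ n : ℕ, e i = n → ∃ k : ℕ, e' i = k ∧ k + p i ≤ n + q i := by
      intro i n hn
      have h1 := H i
      rw [hn] at h1
      have h2 : e' i ≠ ⊤ := by
        rintro h3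
        rw [h3] at h1
        norm_cast at h1
      obtain ⟨k, hk⟩ := ENat.ne_top_iff_exists.1 h2
      rw [← hk] at h1
      norm_cast at h1
      exact ⟨k, hk.symm, h1⟩
    refine ⟨fun i n hn => ?_, fun i => ?_⟩
    · obtain ⟨k, -, hk⟩ := key i n hn
      have := h i
      omega
    · by_cases ht : e i = ⊤
      · rw [rest_apply_top ht]
        exact le_top
      · obtain ⟨n, hn⟩ := ENat.ne_top_iff_exists.1 ht
        obtain ⟨k, hk, hk'⟩ := key i n hn.symm
        rw [rest_apply_nat hn.symm, hk]
        have := h i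
        rw [Nat.cast_le]
        omega
  · rintro ⟨h1, h2⟩ i
    by_cases ht : e i = ⊤
    · simp [ht]
    · obtain ⟨n, hn⟩ := ENat.ne_top_iff_exists.1 ht
      have h3 := h2 i
      have h4 := h1 i n hn.symm
      have := h i
      rw [rest_apply_nat hn.symm] at h3
      obtain ⟨k, hk⟩ := ENat.ne_top_iff_exists.1 (ne_top_of_le_ne_top (ENat.natCast_ne_top _) h3)
      rw [← hk] at h3 ⊢
      rw [← hn]
      rw [Nat.cast_le] at h3
      norm_cast
      omega

theorem payable_iff_le_add {c : ι → ℤ} {e : ι → ℕ∞} {p q : ι → ℕ} (h : ∀ i, c i = p i - q i) :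
    Payable c e ↔ ∀ i, (p i : ℕ∞) ≤ e i + q i := by
  have := add_le_add_iff_rest (e := e) (e' := 0) h
  simp only [Pi.zero_apply, zero_add] at this
  rw [this]
  exact ⟨fun h => ⟨h, fun i => zero_le⟩, And.left⟩

theorem rest_le_iff {c : ι → ℤ} {e e' : ι → ℕ∞} {p q : ι → ℕ} (h : ∀ i, c i = p i - q i) :
    rest c e ≤ e' ↔ ∀ i, e i + q i ≤ e' i + p i := by
  refine forall_congr' fun i => ?_
  have hi := h i
  by_cases ht' : e' i = ⊤
  · simp [ht']
  · obtain ⟨n', hn'⟩ := ENat.ne_top_iff_exists.1 ht'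
    by_cases ht : e i = ⊤
    · rw [rest_apply_top ht, ht, ← hn']
      norm_cast
      simp
    · obtain ⟨n, hn⟩ := ENat.ne_top_iff_exists.1 ht
      rw [rest_apply_nat hn.symm, ← hn, ← hn']
      rw [Nat.cast_le]
      norm_cast
      omega

end Payment

section Certificates

variable {S ι : Type*}

/-- From every position of `V`, some move stays in `Φ` and leads, whatever the antagonist does,
to a position with at least the budget of one in `V`. -/
def BoxClosed (G : Set (Move S ι)) (Φ : Set S) (V : Set (S × (ι → ℕ∞))) : Prop :=
  ∀ s e, (s, e) ∈ V → s ∈ Φ ∧ ∃ m ∈ G, m.src = s ∧ Payable m.cost e ∧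
    ∀ t ∈ m.out, ∃ e' ≤ rest m.cost e, (t, e') ∈ V

/-- From every position of rank `k` in `C`, the antagonist wins the safety game for `Φ` within
`k` rounds, by moving to positions of smaller rank with at most the budget of one in `C`. -/
def BoxRefuted (G : Set (Move S ι)) (Φ : Set S) (C : Set (ℕ × S × (ι → ℕ∞))) : Prop :=
  ∀ k s e, (k, s, e) ∈ C → s ∈ Φ → ∀ m ∈ G, m.src = s → Payable m.cost e →
    ∃ t ∈ m.out, ∃ k' < k, ∃ e', rest m.cost e ≤ e' ∧ (k', t, e') ∈ C

/-- From every position of rank `k` in `C`, the protagonist reaches `Ψ` through `Φ` within `k`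
rounds, by moving to positions of smaller rank with at least the budget of one in `C`. -/
def UntilRanked (G : Set (Move S ι)) (Φ Ψ : Set S) (C : Set (ℕ × S × (ι → ℕ∞))) : Prop :=
  ∀ k s e, (k, s, e) ∈ C → s ∈ Ψ ∨ s ∈ Φ ∧ ∃ m ∈ G, m.src = s ∧ Payable m.cost e ∧
    ∀ t ∈ m.out, ∃ k' < k, ∃ e' ≤ rest m.cost e, (k', t, e') ∈ C

/-- A set of positions outside `Ψ` in which the antagonist keeps the play as long as it is
in `Φ`. -/
def UntilTrap (G : Set (Move S ι)) (Φ Ψ : Set S) (L : Set (S × (ι → ℕ∞))) : Prop :=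
  ∀ s e, (s, e) ∈ L → s ∉ Ψ ∧ (s ∈ Φ → ∀ m ∈ G, m.src = s → Payable m.cost e →
    ∃ t ∈ m.out, ∃ e', rest m.cost e ≤ e' ∧ (t, e') ∈ L)

/-- Dickson's lemma, in the form of finitely many minimal elements. -/
theorem finite_setOf_minimal [Finite ι] (P : (ι → ℕ∞) → Prop) : {e | Minimal P e}.Finite :=
  WellQuasiOrderedLE.finite_of_isAntichain (setOfPred_minimal_antichain P)

theorem finite_setOf_maximal [Finite ι] (P : (ι → ℕ∞) → Prop) : {e | Maximal P e}.Finite :=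
  WellQuasiOrderedLE.finite_of_isAntichain (setOfPred_maximal_antichain P)

theorem finite_positions {T : Set S} (hT : T.Finite) {P : S → (ι → ℕ∞) → Prop}
    (hP : ∀ s, {e | P s e}.Finite) : {x : S × (ι → ℕ∞) | x.1 ∈ T ∧ P x.1 x.2}.Finite := by
  refine (hT.biUnion fun s _ => (hP s).image (Prod.mk s)).subset ?_
  rintro ⟨s, e⟩ ⟨h1, h2⟩
  simp only [Set.mem_iUnion]
  exact ⟨s, h1, e, h2, rfl⟩

/-- In a safety game with finitely many moves, either the protagonist wins by a finite set of
positions (the minimal winning ones, finite in number by Dickson's lemma), or the antagonist wins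
by a finite ranked set. -/
theorem exists_boxClosed_or_boxRefuted [Finite ι] {G : Set (Move S ι)} (hG : G.Finite) (Φ : Set S)
    (s : S) (e : ι → ℕ∞) :
    (∃ B, B.Finite ∧ BoxClosed G Φ B ∧ ∃ e' ≤ e, (s, e') ∈ B) ∨
      ∃ C, C.Finite ∧ BoxRefuted G Φ C ∧ ∃ k e', e ≤ e' ∧ (k, s, e') ∈ C := by
  set Lose : S → (ι → ℕ∞) → Prop := fun s e =>
    ∃ C, C.Finite ∧ BoxRefuted G Φ C ∧ ∃ k e', e ≤ e' ∧ (k, s, e') ∈ C with hLose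
  have step : ∀ s e, ¬ Lose s e → s ∈ Φ ∧ ∃ m ∈ G, m.src = s ∧ Payable m.cost e ∧
      ∀ t ∈ m.out, ¬ Lose t (rest m.cost e) := by
    intro s e h
    by_contra! hcon
    apply h
    by_cases hs : s ∈ Φ
    · have h1 : ∀ m ∈ {m ∈ G | m.src = s ∧ Payable m.cost e}, ∃ t ∈ m.out,
          Lose t (rest m.cost e) := fun m hm => hcon hs m hm.1 hm.2.1 hm.2.2
      have : Nonempty S := ⟨s⟩
      choose! t ht C hC hCr k e' he' hmem using h1
      have hfin := hG.subset (Set.sep_subset G fun m => m.src = s ∧ Payable m.cost e)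
      set G' := {m ∈ G | m.src = s ∧ Payable m.cost e}
      obtain ⟨N, hN⟩ := (hfin.image k).bddAbove
      refine ⟨insert (N + 1, s, e) (⋃ m ∈ G', C m), (hfin.biUnion hC).insert _, ?_, N + 1, e,
        le_rfl, Set.mem_insert _ _⟩
      intro k₁ s₁ e₁ h₁ hΦ m hm hsrc hpay
      rcases h₁ with h₁ | h₁
      · simp only [Prod.mk.injEq] at h₁
        obtain ⟨rfl, rfl, rfl⟩ := h₁
        have hm' : m ∈ G' := ⟨hm, hsrc, hpay⟩
        exact ⟨t m, ht m hm', k m, Nat.lt_succ_of_le (hN ⟨m, hm', rfl⟩), e' m, he' m hm',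
          Set.mem_insert_of_mem _ (Set.mem_biUnion hm' (hmem m hm'))⟩
      · simp only [Set.mem_iUnion] at h₁
        obtain ⟨m', hm', h₁⟩ := h₁
        obtain ⟨t, ht, k', hk', e'', he'', h₂⟩ := hCr m' hm' k₁ s₁ e₁ h₁ hΦ m hm hsrc hpay
        exact ⟨t, ht, k', hk', e'', he'', Set.mem_insert_of_mem _ (Set.mem_biUnion hm' h₂)⟩
    · refine ⟨{(0, s, e)}, Set.finite_singleton _, ?_, 0, e, le_rfl, rfl⟩
      intro k₁ s₁ e₁ h₁ hΦ
      simp only [Set.mem_singleton_iff, Prod.mk.injEq] at h₁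
      exact absurd (h₁.2.1 ▸ hΦ) hs
  rw [or_iff_not_imp_right]
  intro hs
  have below : ∀ s e, ¬ Lose s e → ∃ e' ≤ e, s ∈ Move.src '' G ∧ Minimal (¬ Lose s ·) e' := by
    intro s e h
    obtain ⟨-, m, hm, hsrc, -⟩ := step s e h
    obtain ⟨e', he', hmin⟩ := exists_minimal_le_of_wellFoundedLT (¬ Lose s ·) e h
    exact ⟨e', he', ⟨m, hm, hsrc⟩, hmin⟩
  refine ⟨{x | x.1 ∈ Move.src '' G ∧ Minimal (¬ Lose x.1 ·) x.2},
    finite_positions (P := fun s e => Minimal (¬ Lose s ·) e) (hG.image _)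
      (fun s => finite_setOf_minimal _), ?_, below s e hs⟩
  rintro s e ⟨-, hmin⟩
  obtain ⟨hΦ, m, hm, hsrc, hpay, hout⟩ := step s e hmin.prop
  exact ⟨hΦ, m, hm, hsrc, hpay, fun t ht => below t _ (hout t ht)⟩

/-- The finite vectors are compact: one below the supremum of a chain is below a member. -/
theorem exists_le_of_le_sSup_chain [Finite ι] {c : Set (ι → ℕ∞)} (hc : IsChain (· ≤ ·) c)
    (hne : c.Nonempty) {f : ι → ℕ∞} (hf : ∀ i, f i ≠ ⊤) (hle : f ≤ sSup c) : ∃ z ∈ c, f ≤ z := by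
  have h1 : ∀ i, ∃ z : c, f i ≤ z.1 i := by
    intro i
    obtain ⟨n, hn⟩ := ENat.ne_top_iff_exists.1 (hf i)
    have h2 := hle i
    rw [sSup_apply] at h2
    cases n with
    | zero =>
      obtain ⟨y, hy⟩ := hne
      exact ⟨⟨y, hy⟩, by simp [← hn]⟩
    | succ n =>
      have h3 : (n : ℕ∞) < ⨆ z : c, z.1 i :=
        lt_of_lt_of_le (by rw [← hn]; norm_cast; omega) h2
      obtain ⟨z, hz⟩ := lt_iSup_iff.1 h3
      exact ⟨z, by rw [← hn]; push_cast; exact Order.add_one_le_of_lt hz⟩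
  choose z hz using h1
  have : Nonempty c := hne.to_subtype
  obtain ⟨y, hy⟩ := (directedOn_iff_directed.1 hc.directedOn).finite_le z
  exact ⟨y.1, y.2, fun i => (hz i).trans (hy i i)⟩

/-- In a reachability game with finitely many moves, either the protagonist wins by a finite
ranked set, or the antagonist wins by a finite trap. The trap consists of the maximal positions,
possibly with infinite components, all finite approximations of which are lost; there are finitely
many since they form antichains. -/
theorem exists_untilRanked_or_untilTrap [Finite ι] {G : Set (Move S ι)} (hG : G.Finite)
    (hout : ∀ m ∈ G, m.out.Finite) (Φ Ψ : Set S) (s : S) (e : ι → ℕ∞) :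
    (∃ C, C.Finite ∧ UntilRanked G Φ Ψ C ∧ ∃ k, ∃ e' ≤ e, (k, s, e') ∈ C) ∨
      ∃ L, L.Finite ∧ UntilTrap G Φ Ψ L ∧ ∃ e', e ≤ e' ∧ (s, e') ∈ L := by
  set Win : S → (ι → ℕ∞) → Prop := fun s e =>
    ∃ C, C.Finite ∧ UntilRanked G Φ Ψ C ∧ ∃ k, ∃ e' ≤ e, (k, s, e') ∈ C with hWin
  have mono : ∀ s e e', e ≤ e' → Win s e → Win s e' := by
    rintro s e e' hle ⟨C, h1, h2, k, e'', h3, h4⟩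
    exact ⟨C, h1, h2, k, e'', h3.trans hle, h4⟩
  have base : ∀ s e, s ∈ Ψ → Win s e := by
    intro s e hs
    refine ⟨{(0, s, e)}, Set.finite_singleton _, ?_, 0, e, le_rfl, rfl⟩
    intro k₁ s₁ e₁ h₁
    simp only [Set.mem_singleton_iff, Prod.mk.injEq] at h₁
    exact Or.inl (h₁.2.1 ▸ hs)
  have step : ∀ s e, s ∈ Φ → ∀ m ∈ G, m.src = s → Payable m.cost e →
      (∀ t ∈ m.out, Win t (rest m.cost e)) → Win s e := by
    intro s e hs m hm hsrc hpay h
    choose! C hC hCr k e' he' hmem using h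
    obtain ⟨N, hN⟩ := ((hout m hm).image k).bddAbove
    refine ⟨insert (N + 1, s, e) (⋃ t ∈ m.out, C t), ((hout m hm).biUnion hC).insert _, ?_, N + 1, e,
      le_rfl, Set.mem_insert _ _⟩
    intro k₁ s₁ e₁ h₁
    rcases h₁ with h₁ | h₁
    · simp only [Prod.mk.injEq] at h₁
      obtain ⟨rfl, rfl, rfl⟩ := h₁
      exact Or.inr ⟨hs, m, hm, hsrc, hpay, fun t ht => ⟨k t, Nat.lt_succ_of_le (hN ⟨t, ht, rfl⟩),
        e' t, he' t ht, Set.mem_insert_of_mem _ (Set.mem_biUnion ht (hmem t ht))⟩⟩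
    · simp only [Set.mem_iUnion] at h₁
      obtain ⟨t', ht', h₁⟩ := h₁
      refine (hCr t' ht' k₁ s₁ e₁ h₁).imp_right ?_
      rintro ⟨hΦ, m', hm', hsrc', hpay', h₂⟩
      refine ⟨hΦ, m', hm', hsrc', hpay', fun t ht => ?_⟩
      obtain ⟨k', hk', e'', he'', h₃⟩ := h₂ t ht
      exact ⟨k', hk', e'', he'', Set.mem_insert_of_mem _ (Set.mem_biUnion ht' h₃)⟩
  rw [or_iff_not_imp_left]
  intro hs
  set Lost : S → Set (ι → ℕ∞) := fun s => {e | ∀ f ≤ e, (∀ i, f i ≠ ⊤) → ¬ Win s f} with hLost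
  have above : ∀ s, ∀ e ∈ Lost s, ∃ e', e ≤ e' ∧ Maximal (· ∈ Lost s) e' := by
    intro s e he
    refine zorn_le_nonempty₀ (Lost s) (fun c hc hchain y hy => ?_) e he
    refine ⟨sSup c, fun f hf hfin => ?_, fun z hz => le_sSup hz⟩
    obtain ⟨z, hz, hfz⟩ := exists_le_of_le_sSup_chain hchain ⟨y, hy⟩ hfin hf
    exact hc hz f hfz hfin
  set T : Set S := insert s (⋃ m ∈ G, m.out) with hT
  have hTfin : T.Finite := (hG.biUnion hout).insert _
  have hs' : e ∈ Lost s := fun f hf _ hw => hs (mono s f e hf hw)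
  obtain ⟨e₀, he₀, hmax₀⟩ := above s e hs'
  refine ⟨{x | x.1 ∈ T ∧ Maximal (· ∈ Lost x.1) x.2},
    finite_positions (P := fun s e => Maximal (· ∈ Lost s) e) hTfin
      (fun s => finite_setOf_maximal _), ?_, e₀, he₀, Set.mem_insert _ _, hmax₀⟩
  rintro s₁ e₁ ⟨-, hmax⟩
  have hlost : e₁ ∈ Lost s₁ := hmax.prop
  refine ⟨fun hΨ => hlost 0 (fun i => zero_le) (by simp) (base s₁ 0 hΨ),
    fun hΦ m hm hsrc hpay => ?_⟩
  suffices h : ∃ t ∈ m.out, rest m.cost e₁ ∈ Lost t by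
    obtain ⟨t, ht, hl⟩ := h
    obtain ⟨e', he', hmax'⟩ := above t _ hl
    exact ⟨t, ht, e', he', Set.mem_insert_of_mem _ (Set.mem_biUnion hm ht), hmax'⟩
  by_contra! hcon
  simp only [hLost, Set.mem_ofPred_eq, not_forall, not_not] at hcon
  choose! f hf hfin hfw using hcon
  -- One finite vector that serves all answers of the antagonist.
  set g : ι → ℕ∞ := fun i => (hout m hm).toFinset.sup fun t => f t i with hg
  have hgfin : ∀ i, g i ≠ ⊤ := by
    intro i
    rw [← lt_top_iff_ne_top, hg, Finset.sup_lt_iff (by simp)]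
    intro t ht
    exact lt_top_iff_ne_top.2 (hfin t ((hout m hm).mem_toFinset.1 ht) i)
  have hgle : g ≤ rest m.cost e₁ := by
    intro i
    refine Finset.sup_le fun t ht => ?_
    exact hf t ((hout m hm).mem_toFinset.1 ht) i
  have hgw : ∀ t ∈ m.out, Win t g := by
    intro t ht
    refine mono t (f t) g (fun i => ?_) (hfw t ht)
    exact Finset.le_sup (f := fun t => f t i) ((hout m hm).mem_toFinset.2 ht)
  classical
  -- A finite budget below `e₁` that covers the move and leaves at least `g`.
  set e₂ : ι → ℕ∞ := fun i => if e₁ i = ⊤ then g i + ((m.cost i).toNat : ℕ∞) else e₁ i with he₂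
  refine hlost e₂ (fun i => ?_) (fun i => ?_) (step s₁ e₂ hΦ m hm hsrc (fun i n hn => ?_)
    fun t ht => mono t g _ (fun i => ?_) (hgw t ht))
  · by_cases h : e₁ i = ⊤ <;> simp [he₂, h]
  · by_cases h : e₁ i = ⊤ <;> simp [he₂, h, hgfin]
  · by_cases h : e₁ i = ⊤
    · simp only [he₂, h, if_true] at hn
      obtain ⟨k, hk⟩ := ENat.ne_top_iff_exists.1 (hgfin i)
      rw [← hk] at hn
      norm_cast at hn
      omega
    · simp only [he₂, h, if_false] at hn
      exact hpay i n hn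
  · by_cases h : e₁ i = ⊤
    · obtain ⟨k, hk⟩ := ENat.ne_top_iff_exists.1 (hgfin i)
      have : e₂ i = ((k + (m.cost i).toNat : ℕ) : ℕ∞) := by simp [he₂, h, ← hk]
      rw [rest_apply_nat this, ← hk]
      rw [Nat.cast_le]
      omega
    · have : rest m.cost e₂ i = rest m.cost e₁ i := by simp [rest, he₂, h]
      rw [this]
      exact hgle i

end Certificates

/-! ### Strategies and certificates -/

section Costs

variable {ι : Type*}

/-- All partial sums of the sequence `c` of costs are within the budget `e`. -/
def CostsBounded (c : ℕ → ι → ℤ) (e : ι → ℕ∞) : Prop :=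
  ∀ (i : ℕ) (ρ : ι) (n : ℕ), e ρ = n → ∑ j ∈ Finset.range (i + 1), c j ρ ≤ n

theorem CostsBounded.payable {c : ℕ → ι → ℤ} {e : ι → ℕ∞} (h : CostsBounded c e) :
    Payable (c 0) e := fun ρ n hn => by simpa using h 0 ρ n hn

theorem CostsBounded.tail {c : ℕ → ι → ℤ} {e : ι → ℕ∞} (h : CostsBounded c e) :
    CostsBounded (fun i => c (i + 1)) (rest (c 0) e) := by
  intro i ρ n hn
  have ht : e ρ ≠ ⊤ := by
    intro ht
    rw [rest_apply_top ht] at hn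
    exact ENat.top_ne_natCast n hn
  obtain ⟨k, hk⟩ := ENat.ne_top_iff_exists.1 ht
  have h1 := h (i + 1) ρ k hk.symm
  have h2 := h.payable ρ k hk.symm
  rw [Finset.sum_range_succ'] at h1
  rw [rest_apply_nat hk.symm, Nat.cast_inj] at hn
  simp only
  omega

theorem costsBounded_of_payable {c : ℕ → ι → ℤ} {e : ℕ → ι → ℕ∞}
    (hpay : ∀ i, Payable (c i) (e i)) (hrest : ∀ i, e (i + 1) = rest (c i) (e i)) :
    CostsBounded c (e 0) := by
  intro i ρ n hn
  have key : ∀ i, ∃ k : ℕ, e i ρ = k ∧ (k : ℤ) = n - ∑ j ∈ Finset.range i, c j ρ := by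
    intro i
    induction i with
    | zero => exact ⟨n, hn, by simp⟩
    | succ i ih =>
      obtain ⟨k, hk, hk'⟩ := ih
      refine ⟨(k - c i ρ).toNat, by rw [hrest, rest_apply_nat hk], ?_⟩
      have := hpay i ρ k hk
      rw [Finset.sum_range_succ]
      omega
  obtain ⟨k, -, hk'⟩ := key (i + 1)
  omega

theorem payable_zero (e : ι → ℕ∞) : Payable 0 e := fun i n _ => by simp

theorem rest_zero (e : ι → ℕ∞) : rest 0 e = e := by
  funext i
  simp [rest]

end Costs

namespace RBCGS

variable {Agt Res S Prp Act S' : Type*} {M : RBCGS Agt Res S Prp Act} {A : Finset Agt}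

/-- The joint action in which everyone idles. -/
def idleAction (M : RBCGS Agt Res S Prp Act) (A : Finset Agt) (s : S) : M.JointAction A s :=
  fun a => ⟨M.idle, M.idle_mem s a⟩

theorem jointCost_idleAction (s : S) : M.jointCost _ (M.idleAction A s) = 0 := by
  simp [jointCost, idleAction, M.cost_idle]

theorem outcomes_nonempty {s : S} (σ : M.JointAction A s) : (M.outcomes _ σ).Nonempty := by
  classical
  refine ⟨_, fun a => if h : a ∈ A then σ ⟨a, h⟩ else ⟨M.idle, M.idle_mem s a⟩, ?_, rfl⟩
  rintro ⟨a, h⟩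
  simp [h]

/-- The energy game of the coalition `A`, with the states renamed by `f`: a move is a joint action
of `A`, and the antagonist resolves the choices of the other agents. -/
def arena (M : RBCGS Agt Res S Prp Act) (A : Finset Agt) (f : S → S') : Set (Move S' Res) :=
  {m | ∃ (s : S) (σ : M.JointAction A s), m = ⟨f s, M.jointCost _ σ, f '' M.outcomes _ σ⟩}

theorem exists_of_mem_arena {f : S → S'} (hf : f.Injective) {m : Move S' Res}
    (hm : m ∈ M.arena A f) {s : S} (hs : m.src = f s) :
    ∃ σ : M.JointAction A s, m.cost = M.jointCost _ σ ∧ m.out = f '' M.outcomes _ σ := by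
  obtain ⟨s', σ, rfl⟩ := hm
  obtain rfl := hf hs
  exact ⟨σ, rfl, rfl⟩

namespace Strategy

/-- The costs of the coalition along the computation `w`. -/
def costs (F : M.Strategy A) (w : ℕ → S) (i : ℕ) : Res → ℤ := M.jointCost _ (F.choice w i)

theorem isBounded_iff {F : M.Strategy A} {b : Res → ℕ∞} :
    F.IsBounded b ↔ ∀ s, ∀ w ∈ F.out s, CostsBounded (F.costs w) b := by
  refine forall_congr' fun s => ?_
  constructor
  · intro h w hw
    rw [h] at hw
    exact hw.2
  · intro h
    ext w
    exact ⟨fun hw => ⟨hw, h w hw⟩, And.left⟩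

/-- The strategy that remains of `F` once the play has left `s`. -/
def tail (F : M.Strategy A) (s : S) : M.Strategy A := fun h t => F (s :: h) t

/-- The computation `s, w 0, w 1, …`. -/
def consPath (s : S) (w : ℕ → S) : ℕ → S
  | 0 => s
  | i + 1 => w i

theorem choice_consPath_succ (F : M.Strategy A) (s : S) (w : ℕ → S) (i : ℕ) :
    F.choice (consPath s w) (i + 1) = (F.tail s).choice w i := by
  simp only [choice, tail, List.range_succ_eq_map, List.map_cons, List.map_map]
  rfl

theorem consPath_mem_out {F : M.Strategy A} {s t : S} {w : ℕ → S}
    (ht : t ∈ M.outcomes _ (F [] s)) (hw : w ∈ (F.tail s).out t) : consPath s w ∈ F.out s := by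
  refine ⟨rfl, fun i => ?_⟩
  cases i with
  | zero =>
    have : w 0 = t := hw.1
    change w 0 ∈ M.outcomes _ (F [] s)
    rwa [this]
  | succ i =>
    rw [choice_consPath_succ]
    exact hw.2 i

theorem costs_consPath_succ (F : M.Strategy A) (s : S) (w : ℕ → S) :
    (fun i => F.costs (consPath s w) (i + 1)) = (F.tail s).costs w := by
  funext i
  simp only [costs, choice_consPath_succ]
  rfl

/-- A property of strategies and states that some outcome always preserves is preserved along a
whole computation. -/
theorem exists_mem_out (P : M.Strategy A → S → Prop)
    (hP : ∀ F s, P F s → ∃ t ∈ M.outcomes _ (F [] s), P (F.tail s) t) {F : M.Strategy A} {s : S}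
    (h : P F s) : ∃ w ∈ F.out s, ∀ i, ∃ F', P F' (w i) := by
  choose! next hnext hPnext using hP
  let x : ℕ → M.Strategy A × S := fun n => Nat.rec (F, s) (fun _ y => (y.1.tail y.2, next y.1 y.2)) n
  have hx : ∀ n, x (n + 1) = ((x n).1.tail (x n).2, next (x n).1 (x n).2) := fun _ => rfl
  have hPx : ∀ n, P (x n).1 (x n).2 := by
    intro n
    induction n with
    | zero => exact h
    | succ n ih => rw [hx]; exact hPnext _ _ ih
  have hF : ∀ n h t, (x n).1 h t = F ((List.range n).map (fun i => (x i).2) ++ h) t := by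
    intro n
    induction n with
    | zero => intro h t; rfl
    | succ n ih =>
      intro h t
      rw [hx, List.range_succ]
      simp only [tail, ih, List.map_append, List.map_cons, List.map_nil, List.append_assoc,
        List.cons_append, List.nil_append]
  refine ⟨fun i => (x i).2, ⟨rfl, fun i => ?_⟩, fun i => ⟨_, hPx i⟩⟩
  have h1 := hnext _ _ (hPx i)
  rw [hF, List.append_nil] at h1
  exact h1

theorem out_nonempty (F : M.Strategy A) (s : S) : (F.out s).Nonempty := by
  obtain ⟨w, hw, -⟩ := exists_mem_out (fun _ _ => True)
    (fun F s _ => (outcomes_nonempty (F [] s)).imp fun t ht => ⟨ht, trivial⟩) (F := F) (s := s)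
    trivial
  exact ⟨w, hw⟩

theorem payable_of_costsBounded {F : M.Strategy A} {s : S} {e : Res → ℕ∞}
    (h : ∀ w ∈ F.out s, CostsBounded (F.costs w) e) : Payable (M.jointCost _ (F [] s)) e := by
  obtain ⟨t, ht⟩ := outcomes_nonempty (F [] s)
  obtain ⟨w, hw⟩ := out_nonempty (F.tail s) t
  exact (h _ (consPath_mem_out ht hw)).payable

theorem costsBounded_tail {F : M.Strategy A} {s t : S} {e : Res → ℕ∞}
    (h : ∀ w ∈ F.out s, CostsBounded (F.costs w) e) (ht : t ∈ M.outcomes _ (F [] s)) :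
    ∀ w ∈ (F.tail s).out t, CostsBounded ((F.tail s).costs w) (rest (M.jointCost _ (F [] s)) e) := by
  intro w hw
  have := (h _ (consPath_mem_out ht hw)).tail
  rwa [costs_consPath_succ] at this

/-- The budget left after the history `h` when the coalition acts according to `pick`, a choice
of actions that depends on the current state and the current budget. -/
def residual (pick : (s : S) → (Res → ℕ∞) → M.JointAction A s) (b : Res → ℕ∞) (h : List S) :
    Res → ℕ∞ :=
  h.foldl (fun e s => rest (M.jointCost _ (pick s e)) e) b

/-- The strategy that acts according to `pick`, recomputing the current budget from the history. -/
def ofPick (pick : (s : S) → (Res → ℕ∞) → M.JointAction A s) (b : Res → ℕ∞) : M.Strategy A :=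
  fun h s => pick s (residual pick b h)

theorem residual_range_succ (pick : (s : S) → (Res → ℕ∞) → M.JointAction A s) (b : Res → ℕ∞)
    (w : ℕ → S) (i : ℕ) :
    residual pick b ((List.range (i + 1)).map w) =
      rest ((ofPick pick b).costs w i) (residual pick b ((List.range i).map w)) := by
  simp [residual, List.range_succ, costs, choice, ofPick]

theorem isBounded_ofPick {pick : (s : S) → (Res → ℕ∞) → M.JointAction A s}
    (h : ∀ s e, Payable (M.jointCost _ (pick s e)) e) (b : Res → ℕ∞) :
    (ofPick pick b).IsBounded b := by
  rw [isBounded_iff]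
  intro s w _
  exact costsBounded_of_payable (e := fun i => residual pick b ((List.range i).map w))
    (fun i => h _ _) (residual_range_succ pick b w)

end Strategy

open Strategy

variable {f : S → S'} {b : Res → ℕ∞} {s : S}

theorem exists_next_iff (hf : f.Injective) {Φ : Set S'} :
    (∃ F : M.Strategy A, F.IsBounded b ∧ ∀ w ∈ F.out s, f (w 1) ∈ Φ) ↔
      ∃ m ∈ M.arena A f, m.src = f s ∧ Payable m.cost b ∧ ∀ t ∈ m.out, t ∈ Φ := by
  constructor
  · rintro ⟨F, hF, h⟩
    refine ⟨_, ⟨s, F [] s, rfl⟩, rfl, payable_of_costsBounded (isBounded_iff.1 hF s), ?_⟩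
    rintro _ ⟨t, ht, rfl⟩
    obtain ⟨w, hw⟩ := out_nonempty (F.tail s) t
    have := h _ (consPath_mem_out ht hw)
    change f (w 0) ∈ Φ at this
    rwa [hw.1] at this
  · rintro ⟨m, hm, hsrc, hpay, hout⟩
    obtain ⟨σ, hσ, hσ'⟩ := exists_of_mem_arena hf hm hsrc
    have h1 : ∀ t, ∃ τ : M.JointAction A t, Payable (M.jointCost _ τ) b ∧
        (t = s → ∀ u ∈ M.outcomes _ τ, f u ∈ Φ) := by
      intro t
      by_cases ht : t = s
      · subst ht
        exact ⟨σ, hσ ▸ hpay, fun _ u hu => hout _ (hσ' ▸ Set.mem_image_of_mem f hu)⟩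
      · exact ⟨M.idleAction A t, by rw [jointCost_idleAction]; exact payable_zero b,
          fun h => absurd h ht⟩
    choose g hg hg' using h1
    let F : M.Strategy A := fun h t => match h with
      | [] => g t
      | _ :: _ => M.idleAction A t
    have hF0 : ∀ w, F.choice w 0 = g (w 0) := fun w => rfl
    have hF1 : ∀ w i, F.choice w (i + 1) = M.idleAction A (w (i + 1)) := by
      intro w i
      simp only [Strategy.choice, List.range_succ_eq_map, List.map_cons, F]
    refine ⟨F, isBounded_iff.2 fun s' w _ => ?_, fun w hw => ?_⟩
    · refine costsBounded_of_payable
        (e := fun i => Nat.casesOn i b fun _ => rest (M.jointCost _ (g (w 0))) b) ?_ ?_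
      · rintro (_ | i)
        · exact hg _
        · simp only [costs, hF1, jointCost_idleAction]
          exact payable_zero _
      · rintro (_ | i)
        · rfl
        · simp only [costs, hF1, jointCost_idleAction, rest_zero]
    · exact hg' (w 0) hw.1 _ (hw.2 0)

/-- A closed set of positions is a winning strategy in the safety game: the coalition recomputes
its budget from the history and stays above the set. Off the set it idles, so the bound is kept
from every state. -/
theorem exists_box_of_boxClosed (hf : f.Injective) {Φ : Set S'} {V : Set (S' × (Res → ℕ∞))}
    (hV : BoxClosed (M.arena A f) Φ V) {e : Res → ℕ∞} (he : e ≤ b) (hs : (f s, e) ∈ V) :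
    ∃ F : M.Strategy A, F.IsBounded b ∧ ∀ w ∈ F.out s, ∀ i, f (w i) ∈ Φ := by
  have h1 : ∀ s e, ∃ σ : M.JointAction A s, Payable (M.jointCost _ σ) e ∧
      ((∃ e' ≤ e, (f s, e') ∈ V) →
        ∀ t ∈ M.outcomes _ σ, ∃ e' ≤ rest (M.jointCost _ σ) e, (f t, e') ∈ V) := by
    intro s e
    by_cases h : ∃ e' ≤ e, (f s, e') ∈ V
    · obtain ⟨e', he', hmem⟩ := h
      obtain ⟨-, m, hm, hsrc, hpay, hout⟩ := hV _ _ hmem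
      obtain ⟨σ, hσ, hσ'⟩ := exists_of_mem_arena hf hm hsrc
      rw [hσ] at hpay hout
      refine ⟨σ, hpay.mono he', fun _ t ht => ?_⟩
      obtain ⟨e'', h2, h3⟩ := hout (f t) (hσ' ▸ Set.mem_image_of_mem f ht)
      exact ⟨e'', h2.trans (rest_mono he'), h3⟩
    · exact ⟨M.idleAction A s, by rw [jointCost_idleAction]; exact payable_zero e,
        fun h' => absurd h' h⟩
  choose pick hpay hpick using h1
  refine ⟨ofPick pick b, isBounded_ofPick hpay b, fun w hw i => ?_⟩
  suffices h : ∃ e' ≤ residual pick b ((List.range i).map w), (f (w i), e') ∈ V by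
    obtain ⟨e', -, h⟩ := h
    exact (hV _ _ h).1
  induction i with
  | zero =>
    rw [hw.1]
    exact ⟨e, he, hs⟩
  | succ i ih =>
    rw [residual_range_succ]
    exact hpick _ _ ih _ (hw.2 i)

theorem not_exists_box_of_boxRefuted {Φ : Set S'} {C : Set (ℕ × S' × (Res → ℕ∞))}
    (hC : BoxRefuted (M.arena A f) Φ C) {k : ℕ} {e : Res → ℕ∞} (he : b ≤ e)
    (hs : (k, f s, e) ∈ C) :
    ¬ ∃ F : M.Strategy A, F.IsBounded b ∧ ∀ w ∈ F.out s, ∀ i, f (w i) ∈ Φ := by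
  rintro ⟨F, hF, h⟩
  replace hF := isBounded_iff.1 hF s
  induction k using Nat.strong_induction_on generalizing s e F b with
  | _ k ih =>
    have hΦ : f s ∈ Φ := by
      obtain ⟨w, hw⟩ := out_nonempty F s
      simpa [hw.1] using h w hw 0
    have hpay := payable_of_costsBounded hF
    obtain ⟨_, ⟨t, ht, rfl⟩, k', hk', e', he', hmem⟩ := hC k _ e hs hΦ _ ⟨s, F [] s, rfl⟩ rfl
      (hpay.mono he)
    exact ih k' hk' ((rest_mono he).trans he') hmem (F.tail s)
      (fun w hw i => h _ (consPath_mem_out ht hw) (i + 1)) (costsBounded_tail hF ht)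

/-- A ranked set is a winning strategy in the reachability game: the coalition always plays the
move of the least rank available for the current state and budget. -/
theorem exists_until_of_untilRanked (hf : f.Injective) {Φ Ψ : Set S'} {C : Set (ℕ × S' × (Res → ℕ∞))}
    (hC : UntilRanked (M.arena A f) Φ Ψ C) {k : ℕ} {e : Res → ℕ∞} (he : e ≤ b)
    (hs : (k, f s, e) ∈ C) :
    ∃ F : M.Strategy A, F.IsBounded b ∧
      ∀ w ∈ F.out s, ∃ i, f (w i) ∈ Ψ ∧ ∀ j < i, f (w j) ∈ Φ := by
  set P : ℕ → S → (Res → ℕ∞) → Prop := fun k s e => ∃ e' ≤ e, (k, f s, e') ∈ C with hPdef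
  have h1 : ∀ s e, ∃ σ : M.JointAction A s, Payable (M.jointCost _ σ) e ∧
      ∀ k, P k s e → f s ∉ Ψ → f s ∈ Φ ∧
        ∀ t ∈ M.outcomes _ σ, ∃ k' < k, P k' t (rest (M.jointCost _ σ) e) := by
    intro s e
    by_cases h : (∃ k, P k s e) ∧ f s ∉ Ψ
    · classical
      obtain ⟨e', he', hmem⟩ := Nat.find_spec h.1
      obtain ⟨hΦ, m, hm, hsrc, hpay, hout⟩ := (hC _ _ _ hmem).resolve_left h.2
      obtain ⟨σ, hσ, hσ'⟩ := exists_of_mem_arena hf hm hsrc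
      rw [hσ] at hpay hout
      refine ⟨σ, hpay.mono he', fun k hk _ => ⟨hΦ, fun t ht => ?_⟩⟩
      obtain ⟨k', hk', e'', h2, h3⟩ := hout (f t) (hσ' ▸ Set.mem_image_of_mem f ht)
      exact ⟨k', hk'.trans_le (Nat.find_min' h.1 hk), e'', h2.trans (rest_mono he'), h3⟩
    · exact ⟨M.idleAction A s, by rw [jointCost_idleAction]; exact payable_zero e,
        fun k hk hΨ => absurd ⟨⟨k, hk⟩, hΨ⟩ h⟩
  choose pick hpay hpick using h1
  refine ⟨ofPick pick b, isBounded_ofPick hpay b, fun w hw => ?_⟩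
  have key : ∀ k i, P k (w i) (residual pick b ((List.range i).map w)) →
      ∃ j, i ≤ j ∧ f (w j) ∈ Ψ ∧ ∀ l, i ≤ l → l < j → f (w l) ∈ Φ := by
    intro k
    induction k using Nat.strong_induction_on with
    | _ k ih =>
      intro i hk
      by_cases hΨ : f (w i) ∈ Ψ
      · exact ⟨i, le_rfl, hΨ, fun l h1 h2 => absurd h2 h1.not_gt⟩
      · obtain ⟨hΦ, hstep⟩ := hpick _ _ k hk hΨ
        obtain ⟨k', hk', hP⟩ := hstep _ (hw.2 i)
        obtain ⟨j, hij, hj, hl⟩ := ih k' hk' (i + 1) (by rw [residual_range_succ]; exact hP)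
        refine ⟨j, by omega, hj, fun l h1 h2 => ?_⟩
        rcases h1.eq_or_lt with rfl | h1
        · exact hΦ
        · exact hl l h1 h2
  obtain ⟨j, -, hj, hl⟩ := key k 0 (by rw [hw.1]; exact ⟨e, he, hs⟩)
  exact ⟨j, hj, fun l h => hl l (Nat.zero_le l) h⟩

theorem not_exists_until_of_untilTrap {Φ Ψ : Set S'} {L : Set (S' × (Res → ℕ∞))}
    (hL : UntilTrap (M.arena A f) Φ Ψ L) {e : Res → ℕ∞} (he : b ≤ e) (hs : (f s, e) ∈ L) :
    ¬ ∃ F : M.Strategy A, F.IsBounded b ∧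
      ∀ w ∈ F.out s, ∃ i, f (w i) ∈ Ψ ∧ ∀ j < i, f (w j) ∈ Φ := by
  rintro ⟨F, hF, h⟩
  replace hF := isBounded_iff.1 hF s
  -- The invariant: the rest of the strategy still wins within a budget that the trap exceeds.
  let P : M.Strategy A → S → Prop := fun F s => ∃ b e, b ≤ e ∧ (f s, e) ∈ L ∧
    (∀ w ∈ F.out s, CostsBounded (F.costs w) b) ∧
    ∀ w ∈ F.out s, ∃ i, f (w i) ∈ Ψ ∧ ∀ j < i, f (w j) ∈ Φ
  have hP : ∀ F s, P F s → ∃ t ∈ M.outcomes _ (F [] s), P (F.tail s) t := by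
    rintro F s ⟨b, e, he, hs, hF, h⟩
    obtain ⟨hΨ, hstep⟩ := hL _ _ hs
    have key : ∀ w ∈ F.out s, ∃ i, f (w (i + 1)) ∈ Ψ ∧ ∀ j < i + 1, f (w j) ∈ Φ := by
      intro w hw
      obtain ⟨i, hi, hj⟩ := h w hw
      cases i with
      | zero => exact absurd (hw.1 ▸ hi) hΨ
      | succ i => exact ⟨i, hi, hj⟩
    have hΦ : f s ∈ Φ := by
      obtain ⟨w, hw⟩ := out_nonempty F s
      obtain ⟨i, -, hj⟩ := key w hw
      exact hw.1 ▸ hj 0 i.succ_pos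
    obtain ⟨_, ⟨t, ht, rfl⟩, e', he', hmem⟩ := hstep hΦ _ ⟨s, F [] s, rfl⟩ rfl
      ((payable_of_costsBounded hF).mono he)
    refine ⟨t, ht, _, e', (rest_mono he).trans he', hmem, costsBounded_tail hF ht, fun w hw => ?_⟩
    obtain ⟨i, hi, hj⟩ := key _ (consPath_mem_out ht hw)
    exact ⟨i, hi, fun j hji => hj (j + 1) (Nat.succ_lt_succ hji)⟩
  obtain ⟨w, hw, hP⟩ := exists_mem_out P hP (F := F) (s := s) ⟨b, e, he, hs, hF, h⟩
  obtain ⟨i, hi, -⟩ := h w hw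
  obtain ⟨-, -, e', -, h2, -⟩ := hP i
  exact (hL _ _ h2).1 hi

end RBCGS

/-! ### Primitive recursive predicates and computable folds -/

attribute [fun_prop] Primrec
attribute [fun_prop] Primrec.id Primrec.const Primrec.comp Primrec.pair Primrec.fst Primrec.snd

section Toolkit

variable {α β σ : Type*} [Primcodable α] [Primcodable β] [Primcodable σ]

@[fun_prop] theorem primrec_getD (d : β) {f : α → List β} {g : α → ℕ} (hf : Primrec f)
    (hg : Primrec g) : Primrec fun a => (f a).getD (g a) d :=
  (Primrec.list_getD d).comp hf hg

@[fun_prop] theorem primrec_add {f g : α → ℕ} (hf : Primrec f) (hg : Primrec g) :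
    Primrec fun a => f a + g a :=
  Primrec.nat_add.comp hf hg

@[fun_prop] theorem primrec_range {f : α → ℕ} (hf : Primrec f) :
    Primrec fun a => List.range (f a) :=
  Primrec.list_range.comp hf

@[fun_prop] theorem primrec_optionGetD (d : β) {f : α → Option β} (hf : Primrec f) :
    Primrec fun a => (f a).getD d :=
  Primrec.option_getD.comp hf (Primrec.const d)

theorem primrecPred_forall_mem {f : α → List β} {p : α → β → Prop} (hf : Primrec f)
    (hp : PrimrecPred fun x : α × β => p x.1 x.2) : PrimrecPred fun a => ∀ b ∈ f a, p a b :=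
  (PrimrecRel.forall_mem_list (R := fun b a => p a b)
    (hp.comp (Primrec.pair Primrec.snd Primrec.fst))).comp hf Primrec.id

theorem primrecPred_exists_mem {f : α → List β} {p : α → β → Prop} (hf : Primrec f)
    (hp : PrimrecPred fun x : α × β => p x.1 x.2) : PrimrecPred fun a => ∃ b ∈ f a, p a b :=
  (PrimrecRel.exists_mem_list (R := fun b a => p a b)
    (hp.comp (Primrec.pair Primrec.snd Primrec.fst))).comp hf Primrec.id

theorem primrecPred_forall_lt {f : α → ℕ} {p : α → ℕ → Prop} (hf : Primrec f)
    (hp : PrimrecPred fun x : α × ℕ => p x.1 x.2) : PrimrecPred fun a => ∀ i < f a, p a i :=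
  (primrecPred_forall_mem (primrec_range hf) hp).of_eq fun a => by simp

theorem primrecPred_imp {p q : α → Prop} (hp : PrimrecPred p) (hq : PrimrecPred q) :
    PrimrecPred fun a => p a → q a := by
  classical
  exact (hp.not.or hq).of_eq fun a => imp_iff_not_or.symm

theorem primrecPred_eq {f g : α → β} (hf : Primrec f) (hg : Primrec g) :
    PrimrecPred fun a => f a = g a :=
  Primrec.eq.comp hf hg

theorem primrecPred_lt {f g : α → ℕ} (hf : Primrec f) (hg : Primrec g) :
    PrimrecPred fun a => f a < g a :=
  Primrec.nat_lt.comp hf hg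

theorem primrecPred_le {f g : α → ℕ} (hf : Primrec f) (hg : Primrec g) :
    PrimrecPred fun a => f a ≤ g a :=
  Primrec.nat_le.comp hf hg

theorem primrecPred_mem {f : α → List β} {g : α → β} (hf : Primrec f) (hg : Primrec g) :
    PrimrecPred fun a => g a ∈ f a :=
  (primrecPred_exists_mem (p := fun a b => b = g a) hf
    (primrecPred_eq Primrec.snd (hg.comp Primrec.fst))).of_eq fun a => by simp

@[fun_prop] theorem primrec_map {f : α → List β} {g : α → β → σ} (hf : Primrec f)
    (hg : Primrec fun x : α × β => g x.1 x.2) : Primrec fun a => (f a).map (g a) :=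
  Primrec.list_map hf hg

theorem primrec_filter {f : α → List β} {p : α → β → Prop} [∀ a, DecidablePred (p a)]
    (hf : Primrec f) (hp : PrimrecPred fun x : α × β => p x.1 x.2) :
    Primrec fun a => (f a).filter (fun b => p a b) := by
  simp only [← List.filterMap_eq_filter]
  refine Primrec.listFilterMap hf (Primrec.ite ?_ (Primrec.option_some.comp Primrec.snd)
    (Primrec.const Option.none))
  exact Primrec.eq.comp (PrimrecPred.decide hp) (Primrec.const true)

@[fun_prop] theorem primrec_sum {f : α → List ℕ} (hf : Primrec f) :
    Primrec fun a => (f a).sum :=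
  Primrec.list_foldr (h := fun _ x => x.1 + x.2) hf (Primrec.const 0)
    (by unfold Primrec₂; fun_prop)

theorem computable_filter_range {n : α → ℕ} {p : α → ℕ → Bool} (hn : Computable n)
    (hp : Computable fun x : α × ℕ => p x.1 x.2) :
    Computable fun a => (List.range (n a)).filter (p a) := by
  have h : Computable₂ fun (a : α) (x : ℕ × List ℕ) => cond (p a x.1) (x.2 ++ [x.1]) x.2 := by
    refine Computable.cond (hp.comp (Computable.pair Computable.fst
      (Computable.fst.comp Computable.snd))) ?_ (Computable.snd.comp Computable.snd)
    exact Computable.list_concat.comp (Computable.snd.comp Computable.snd)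
      (Computable.fst.comp Computable.snd)
  refine (Computable.nat_rec hn (Computable.const []) h).of_eq fun a => ?_
  induction n a with
  | zero => rfl
  | succ k ih =>
    simp only [ih, List.range_succ, List.filter_append]
    cases hk : p a k <;> simp [hk]

theorem computable_foldr {f : α → List β} {h : α → β → σ → σ} {g : α → σ} (hf : Computable f)
    (hg : Computable g) (hh : Computable fun x : (α × β) × σ => h x.1.1 x.1.2 x.2) :
    Computable fun a => (f a).foldr (h a) (g a) := by
  have h1 : Computable₂ fun (a : α) (x : ℕ × σ) =>
      (Option.casesOn ((f a).reverse[x.1]?) x.2 (fun b => h a b x.2) : σ) := by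
    refine Computable.option_casesOn (Computable.list_getElem?.comp
      (Computable.list_reverse.comp (hf.comp Computable.fst))
      (Computable.fst.comp Computable.snd)) (Computable.snd.comp Computable.snd) ?_
    exact hh.comp (((Computable.fst.comp Computable.fst).pair Computable.snd).pair
      (Computable.snd.comp (Computable.snd.comp Computable.fst)))
  refine (Computable.nat_rec (Computable.list_length.comp hf) hg h1).of_eq fun a => ?_
  rw [← List.foldl_reverse]
  have key : ∀ l : List β, ∀ n ≤ l.length, Nat.rec (motive := fun _ => σ) (g a) (fun i acc =>
      (Option.casesOn (l[i]?) acc (fun b => h a b acc) : σ)) n =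
        (l.take n).foldl (fun x y => h a y x) (g a) := by
    intro l n
    induction n with
    | zero => intro _; simp
    | succ n ih =>
      intro hn
      have h2 : l[n]? = some l[n] := List.getElem?_eq_getElem hn
      simp only [ih (Nat.le_of_succ_le hn), h2]
      rw [List.take_add_one, h2, List.foldl_append]
      rfl
  have := key (f a).reverse _ le_rfl
  rw [List.take_length, List.length_reverse] at this
  exact this

/-- A search through all certificates is a total computable function as soon as every input has a
certificate for one of the two answers. -/
theorem exists_computable_of_certificates {P N : α × β → Prop} (hP : PrimrecPred P)
    (hN : PrimrecPred N) (h : ∀ a, (∃ c, P (a, c)) ∨ ∃ c, N (a, c)) :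
    ∃ f : α → Bool, Computable f ∧ ∀ a, (f a = true → ∃ c, P (a, c)) ∧
      (f a = false → ∃ c, N (a, c)) := by
  classical
  let test : α × β → Option Bool := fun x =>
    if P x then some true else if N x then some false else none
  have htest : Primrec test :=
    Primrec.ite hP (Primrec.const _) (Primrec.ite hN (Primrec.const _) (Primrec.const _))
  let g : α → ℕ → Option Bool := fun a n => (Encodable.decode (α := β) n).bind fun c => test (a, c)
  have hg : Computable₂ g := by
    refine Computable.option_bind (Computable.decode.comp Computable.snd) ?_
    exact htest.to_comp.comp ((Computable.fst.comp Computable.fst).pair Computable.snd)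
  have hdom : ∀ a, (Nat.rfindOpt (g a)).Dom := by
    intro a
    rw [Nat.rfindOpt_dom]
    have : ∃ c v, test (a, c) = some v := by
      rcases h a with ⟨c, hc⟩ | ⟨c, hc⟩
      · exact ⟨c, true, by simp [test, hc]⟩
      · by_cases hc' : P (a, c)
        · exact ⟨c, true, by simp [test, hc']⟩
        · exact ⟨c, false, by simp [test, hc, hc']⟩
    obtain ⟨c, v, hv⟩ := this
    exact ⟨Encodable.encode c, v, by simp [g, hv]⟩
  refine ⟨fun a => (Nat.rfindOpt (g a)).get (hdom a),
    (Partrec.rfindOpt hg).of_eq_tot fun a => Part.get_mem _, fun a => ?_⟩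
  obtain ⟨n, hn⟩ := Nat.rfindOpt_spec (Part.get_mem (hdom a))
  simp only [g, Option.mem_def, Option.bind_eq_some_iff] at hn
  obtain ⟨c, -, hc⟩ := hn
  beta_reduce
  generalize (Nat.rfindOpt (g a)).get (hdom a) = v at hc ⊢
  simp only [test] at hc
  split_ifs at hc with h1 h2
  · exact ⟨fun _ => ⟨c, h1⟩, by simp_all⟩
  · exact ⟨by simp_all, fun _ => ⟨c, h2⟩⟩

end Toolkit

/-! ### Certificates as finite data -/

/-- A move as finite data: the source, the amounts consumed, the amounts produced, and the
possible targets. -/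
abbrev MoveCode : Type := ℕ × List ℕ × List ℕ × List ℕ

/-- A list of positions with their ranks; a position is a state with a budget, in which `none`
stands for an infinite component. -/
abbrev Cert : Type := List (ℕ × ℕ × List (Option ℕ))

/-- The data of an energy game: the moves, the number of resources, the initial budget, two
sets of states, and the initial state. -/
abbrev Query : Type := List MoveCode × ℕ × List (Option ℕ) × List ℕ × List ℕ × ℕ

/-- The extended natural number written as `o`. -/
def extended (o : Option ℕ) : ℕ∞ := o.elim ⊤ (fun n => (n : ℕ∞))

@[simp] theorem extended_some (n : ℕ) : extended (some n) = n := rfl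

@[simp] theorem extended_none : extended none = ⊤ := rfl

/-- The budget written as the list `l`; missing components are `0`. -/
def decodeBudget (r : ℕ) (l : List (Option ℕ)) : Fin r → ℕ∞ :=
  fun i => extended (l.getD i (some 0))

theorem exists_decodeBudget_eq {r : ℕ} (e : Fin r → ℕ∞) : ∃ l, decodeBudget r l = e := by
  have h : ∀ x : ℕ∞, ∃ o, extended o = x := by
    intro x
    cases x with
    | top => exact ⟨none, rfl⟩
    | coe n => exact ⟨some n, rfl⟩
  choose g hg using h
  refine ⟨List.ofFn fun i => g (e i), funext fun i => ?_⟩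
  simp [decodeBudget, List.getD_eq_getElem?_getD, hg]

/-- The move written as `m`. -/
def decodeMove (r : ℕ) (m : MoveCode) : Move ℕ (Fin r) where
  src := m.1
  cost i := (m.2.1.getD i 0 : ℤ) - (m.2.2.1.getD i 0 : ℤ)
  out := {t | t ∈ m.2.2.2}

/-- The energy game with the moves `l`. -/
def gameOf (r : ℕ) (l : List MoveCode) : Set (Move ℕ (Fin r)) := {m | ∃ c ∈ l, decodeMove r c = m}

theorem finite_gameOf (r : ℕ) (l : List MoveCode) : (gameOf r l).Finite :=
  (l.finite_toSet.image (decodeMove r)).subset fun _ hm => hm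

theorem finite_out_of_mem_gameOf {r : ℕ} {l : List MoveCode} {m : Move ℕ (Fin r)}
    (hm : m ∈ gameOf r l) : m.out.Finite := by
  obtain ⟨c, -, rfl⟩ := hm
  exact c.2.2.2.finite_toSet

/-- The ranked positions listed in a certificate. -/
def rankedPositions (r : ℕ) (c : Cert) : Set (ℕ × ℕ × (Fin r → ℕ∞)) :=
  {x | ∃ y ∈ c, (y.1, y.2.1, decodeBudget r y.2.2) = x}

/-- The positions listed in a certificate. -/
def positions (r : ℕ) (c : Cert) : Set (ℕ × (Fin r → ℕ∞)) :=
  {x | ∃ y ∈ c, (y.2.1, decodeBudget r y.2.2) = x}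

theorem exists_rankedPositions_eq {r : ℕ} {C : Set (ℕ × ℕ × (Fin r → ℕ∞))} (hC : C.Finite) :
    ∃ c, rankedPositions r c = C := by
  choose g hg using @exists_decodeBudget_eq r
  refine ⟨hC.toFinset.toList.map fun x => (x.1, x.2.1, g x.2.2), ?_⟩
  ext ⟨k, t, e⟩
  simp [rankedPositions, hg]

theorem exists_positions_eq {r : ℕ} {B : Set (ℕ × (Fin r → ℕ∞))} (hB : B.Finite) :
    ∃ c, positions r c = B := by
  choose g hg using @exists_decodeBudget_eq r
  refine ⟨hB.toFinset.toList.map fun x => (0, x.1, g x.2), ?_⟩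
  ext ⟨t, e⟩
  simp [positions, hg]

/-- `x + u ≤ y + v` in the first `r` components. -/
def BudgetLE (r : ℕ) (x : List (Option ℕ)) (u : List ℕ) (y : List (Option ℕ)) (v : List ℕ) :
    Prop :=
  ∀ i < r, extended (x.getD i (some 0)) + (u.getD i 0 : ℕ) ≤
    extended (y.getD i (some 0)) + (v.getD i 0 : ℕ)

theorem budgetLE_nil_iff {r : ℕ} {x y : List (Option ℕ)} :
    BudgetLE r x [] y [] ↔ decodeBudget r x ≤ decodeBudget r y := by
  simp [BudgetLE, Pi.le_def, Fin.forall_iff, decodeBudget]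

theorem payable_decodeMove_iff {r : ℕ} {m : MoveCode} {y : List (Option ℕ)} :
    Payable (decodeMove r m).cost (decodeBudget r y) ↔ BudgetLE r [] m.2.1 y m.2.2.1 := by
  refine (payable_iff_le_add (c := (decodeMove r m).cost) (p := fun i => m.2.1.getD i 0)
    (q := fun i => m.2.2.1.getD i 0) fun i => rfl).trans ?_
  simp [BudgetLE, Fin.forall_iff, decodeBudget]

theorem rest_decodeMove_le_iff {r : ℕ} {m : MoveCode} {x y : List (Option ℕ)} :
    rest (decodeMove r m).cost (decodeBudget r x) ≤ decodeBudget r y ↔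
      BudgetLE r x m.2.2.1 y m.2.1 := by
  refine (rest_le_iff (c := (decodeMove r m).cost) (p := fun i => m.2.1.getD i 0)
    (q := fun i => m.2.2.1.getD i 0) fun i => rfl).trans ?_
  simp [BudgetLE, Fin.forall_iff, decodeBudget]

theorem payable_and_le_rest_iff {r : ℕ} {m : MoveCode} {x y : List (Option ℕ)} :
    Payable (decodeMove r m).cost (decodeBudget r x) ∧
      decodeBudget r y ≤ rest (decodeMove r m).cost (decodeBudget r x) ↔
      BudgetLE r y m.2.1 x m.2.2.1 := by
  refine (add_le_add_iff_rest (c := (decodeMove r m).cost) (p := fun i => m.2.1.getD i 0)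
    (q := fun i => m.2.2.1.getD i 0) fun i => rfl).symm.trans ?_
  simp [BudgetLE, Fin.forall_iff, decodeBudget]

section Checks

variable (q : Query) (c : Cert)

/-- The test for `⟨⟨A^b⟩⟩ ○ X`. -/
def NextYes : Prop :=
  ∃ m ∈ q.1, m.1 = q.2.2.2.2.2 ∧ BudgetLE q.2.1 [] m.2.1 q.2.2.1 m.2.2.1 ∧
    ∀ t ∈ m.2.2.2, t ∈ q.2.2.2.1

/-- The test that `c` proves `⟨⟨A^b⟩⟩ □ X`. -/
def BoxYes : Prop :=
  (∀ x ∈ c, x.2.1 ∈ q.2.2.2.1 ∧ ∃ m ∈ q.1, m.1 = x.2.1 ∧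
    BudgetLE q.2.1 [] m.2.1 x.2.2 m.2.2.1 ∧
    ∀ t ∈ m.2.2.2, ∃ y ∈ c, BudgetLE q.2.1 y.2.2 m.2.1 x.2.2 m.2.2.1 ∧ y.2.1 = t) ∧
  ∃ x ∈ c, BudgetLE q.2.1 x.2.2 [] q.2.2.1 [] ∧ x.2.1 = q.2.2.2.2.2

/-- The test that `c` refutes `⟨⟨A^b⟩⟩ □ X`. -/
def BoxNo : Prop :=
  (∀ x ∈ c, x.2.1 ∈ q.2.2.2.1 → ∀ m ∈ q.1, m.1 = x.2.1 →
    BudgetLE q.2.1 [] m.2.1 x.2.2 m.2.2.1 →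
    ∃ t ∈ m.2.2.2, ∃ y ∈ c, y.1 < x.1 ∧ BudgetLE q.2.1 x.2.2 m.2.2.1 y.2.2 m.2.1 ∧ y.2.1 = t) ∧
  ∃ x ∈ c, BudgetLE q.2.1 q.2.2.1 [] x.2.2 [] ∧ x.2.1 = q.2.2.2.2.2

/-- The test that `c` proves `⟨⟨A^b⟩⟩ X U Y`. -/
def UntilYes : Prop :=
  (∀ x ∈ c, x.2.1 ∈ q.2.2.2.2.1 ∨ x.2.1 ∈ q.2.2.2.1 ∧ ∃ m ∈ q.1, m.1 = x.2.1 ∧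
    BudgetLE q.2.1 [] m.2.1 x.2.2 m.2.2.1 ∧
    ∀ t ∈ m.2.2.2, ∃ y ∈ c, y.1 < x.1 ∧ BudgetLE q.2.1 y.2.2 m.2.1 x.2.2 m.2.2.1 ∧ y.2.1 = t) ∧
  ∃ x ∈ c, BudgetLE q.2.1 x.2.2 [] q.2.2.1 [] ∧ x.2.1 = q.2.2.2.2.2

/-- The test that `c` refutes `⟨⟨A^b⟩⟩ X U Y`. -/
def UntilNo : Prop :=
  (∀ x ∈ c, x.2.1 ∉ q.2.2.2.2.1 ∧ (x.2.1 ∈ q.2.2.2.1 → ∀ m ∈ q.1, m.1 = x.2.1 →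
    BudgetLE q.2.1 [] m.2.1 x.2.2 m.2.2.1 →
    ∃ t ∈ m.2.2.2, ∃ y ∈ c, BudgetLE q.2.1 x.2.2 m.2.2.1 y.2.2 m.2.1 ∧ y.2.1 = t)) ∧
  ∃ x ∈ c, BudgetLE q.2.1 q.2.2.1 [] x.2.2 [] ∧ x.2.1 = q.2.2.2.2.2

variable {q c}

theorem nextYes_iff : NextYes q ↔ ∃ m ∈ gameOf q.2.1 q.1, m.src = q.2.2.2.2.2 ∧
    Payable m.cost (decodeBudget q.2.1 q.2.2.1) ∧ ∀ t ∈ m.out, t ∈ {t | t ∈ q.2.2.2.1} := by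
  simp only [NextYes, gameOf, ← payable_decodeMove_iff, Set.mem_ofPred_eq, exists_exists_and_eq_and]
  rfl

theorem budgetLE_iff_le_rest {r : ℕ} {m : MoveCode} {x y : List (Option ℕ)}
    (h : BudgetLE r [] m.2.1 x m.2.2.1) : BudgetLE r y m.2.1 x m.2.2.1 ↔
      decodeBudget r y ≤ rest (decodeMove r m).cost (decodeBudget r x) := by
  rw [← payable_and_le_rest_iff, payable_decodeMove_iff]
  exact and_iff_right h

theorem boxYes_iff : BoxYes q c ↔
    BoxClosed (gameOf q.2.1 q.1) {t | t ∈ q.2.2.2.1} (positions q.2.1 c) ∧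
      ∃ e' ≤ decodeBudget q.2.1 q.2.2.1, (q.2.2.2.2.2, e') ∈ positions q.2.1 c := by
  refine and_congr ⟨fun h => ?_, fun h => ?_⟩ ?_
  · rintro s e ⟨x, hx, hxe⟩
    obtain ⟨rfl, rfl⟩ := Prod.mk.injEq _ _ _ _ ▸ hxe
    obtain ⟨hX, m, hm, hsrc, hpay, hout⟩ := h x hx
    refine ⟨hX, _, ⟨m, hm, rfl⟩, hsrc, payable_decodeMove_iff.2 hpay, fun t ht => ?_⟩
    obtain ⟨y, hy, hle, rfl⟩ := hout t ht
    exact ⟨_, (budgetLE_iff_le_rest hpay).1 hle, y, hy, rfl⟩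
  · intro x hx
    obtain ⟨hX, _, ⟨m, hm, rfl⟩, hsrc, hpay, hout⟩ := h _ _ ⟨x, hx, rfl⟩
    rw [payable_decodeMove_iff] at hpay
    refine ⟨hX, m, hm, hsrc, hpay, fun t ht => ?_⟩
    obtain ⟨_, hle, y, hy, hye⟩ := hout t ht
    obtain ⟨rfl, rfl⟩ := Prod.mk.injEq _ _ _ _ ▸ hye
    exact ⟨y, hy, (budgetLE_iff_le_rest hpay).2 hle, rfl⟩
  · simp only [positions, budgetLE_nil_iff, Set.mem_ofPred_eq, Prod.mk.injEq]
    grind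

theorem boxNo_iff : BoxNo q c ↔
    BoxRefuted (gameOf q.2.1 q.1) {t | t ∈ q.2.2.2.1} (rankedPositions q.2.1 c) ∧
      ∃ k e', decodeBudget q.2.1 q.2.2.1 ≤ e' ∧
        (k, q.2.2.2.2.2, e') ∈ rankedPositions q.2.1 c := by
  refine and_congr ⟨fun h => ?_, fun h => ?_⟩ ?_
  · rintro k s e ⟨x, hx, hxe⟩ hX _ ⟨m, hm, rfl⟩ hsrc hpay
    simp only [Prod.mk.injEq] at hxe
    obtain ⟨rfl, rfl, rfl⟩ := hxe
    obtain ⟨t, ht, y, hy, hlt, hle, rfl⟩ := h x hx hX m hm hsrc (payable_decodeMove_iff.1 hpay)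
    exact ⟨_, ht, _, hlt, _, rest_decodeMove_le_iff.2 hle, y, hy, rfl⟩
  · intro x hx hX m hm hsrc hpay
    obtain ⟨t, ht, k, hlt, _, hle, y, hy, hye⟩ :=
      h _ _ _ ⟨x, hx, rfl⟩ hX _ ⟨m, hm, rfl⟩ hsrc (payable_decodeMove_iff.2 hpay)
    simp only [Prod.mk.injEq] at hye
    obtain ⟨rfl, rfl, rfl⟩ := hye
    exact ⟨_, ht, y, hy, hlt, rest_decodeMove_le_iff.1 hle, rfl⟩
  · simp only [rankedPositions, budgetLE_nil_iff, Set.mem_ofPred_eq, Prod.mk.injEq]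
    grind

theorem untilYes_iff : UntilYes q c ↔
    UntilRanked (gameOf q.2.1 q.1) {t | t ∈ q.2.2.2.1} {t | t ∈ q.2.2.2.2.1}
        (rankedPositions q.2.1 c) ∧
      ∃ k, ∃ e' ≤ decodeBudget q.2.1 q.2.2.1,
        (k, q.2.2.2.2.2, e') ∈ rankedPositions q.2.1 c := by
  refine and_congr ⟨fun h => ?_, fun h => ?_⟩ ?_
  · rintro k s e ⟨x, hx, hxe⟩
    simp only [Prod.mk.injEq] at hxe
    obtain ⟨rfl, rfl, rfl⟩ := hxe
    refine (h x hx).imp_right ?_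
    rintro ⟨hX, m, hm, hsrc, hpay, hout⟩
    refine ⟨hX, _, ⟨m, hm, rfl⟩, hsrc, payable_decodeMove_iff.2 hpay, fun t ht => ?_⟩
    obtain ⟨y, hy, hlt, hle, rfl⟩ := hout t ht
    exact ⟨_, hlt, _, (budgetLE_iff_le_rest hpay).1 hle, y, hy, rfl⟩
  · intro x hx
    refine (h _ _ _ ⟨x, hx, rfl⟩).imp_right ?_
    rintro ⟨hX, _, ⟨m, hm, rfl⟩, hsrc, hpay, hout⟩
    rw [payable_decodeMove_iff] at hpay
    refine ⟨hX, m, hm, hsrc, hpay, fun t ht => ?_⟩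
    obtain ⟨_, hlt, _, hle, y, hy, hye⟩ := hout t ht
    simp only [Prod.mk.injEq] at hye
    obtain ⟨rfl, rfl, rfl⟩ := hye
    exact ⟨y, hy, hlt, (budgetLE_iff_le_rest hpay).2 hle, rfl⟩
  · simp only [rankedPositions, budgetLE_nil_iff, Set.mem_ofPred_eq, Prod.mk.injEq]
    grind

theorem untilNo_iff : UntilNo q c ↔
    UntilTrap (gameOf q.2.1 q.1) {t | t ∈ q.2.2.2.1} {t | t ∈ q.2.2.2.2.1}
        (positions q.2.1 c) ∧
      ∃ e', decodeBudget q.2.1 q.2.2.1 ≤ e' ∧ (q.2.2.2.2.2, e') ∈ positions q.2.1 c := by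
  refine and_congr ⟨fun h => ?_, fun h => ?_⟩ ?_
  · rintro s e ⟨x, hx, hxe⟩
    obtain ⟨rfl, rfl⟩ := Prod.mk.injEq _ _ _ _ ▸ hxe
    refine ⟨(h x hx).1, ?_⟩
    rintro hX _ ⟨m, hm, rfl⟩ hsrc hpay
    obtain ⟨t, ht, y, hy, hle, rfl⟩ := (h x hx).2 hX m hm hsrc (payable_decodeMove_iff.1 hpay)
    exact ⟨_, ht, _, rest_decodeMove_le_iff.2 hle, y, hy, rfl⟩
  · intro x hx
    obtain ⟨hY, h⟩ := h _ _ ⟨x, hx, rfl⟩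
    refine ⟨hY, fun hX m hm hsrc hpay => ?_⟩
    obtain ⟨t, ht, _, hle, y, hy, hye⟩ :=
      h hX _ ⟨m, hm, rfl⟩ hsrc (payable_decodeMove_iff.2 hpay)
    obtain ⟨rfl, rfl⟩ := Prod.mk.injEq _ _ _ _ ▸ hye
    exact ⟨_, ht, y, hy, rest_decodeMove_le_iff.1 hle, rfl⟩
  · simp only [positions, budgetLE_nil_iff, Set.mem_ofPred_eq, Prod.mk.injEq]
    grind

theorem exists_boxYes_or_boxNo (q : Query) : (∃ c, BoxYes q c) ∨ ∃ c, BoxNo q c := by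
  rcases exists_boxClosed_or_boxRefuted (finite_gameOf q.2.1 q.1) {t | t ∈ q.2.2.2.1}
    q.2.2.2.2.2 (decodeBudget q.2.1 q.2.2.1) with ⟨B, hB, h⟩ | ⟨C, hC, h⟩
  · obtain ⟨c, rfl⟩ := exists_positions_eq hB
    exact Or.inl ⟨c, boxYes_iff.2 h⟩
  · obtain ⟨c, rfl⟩ := exists_rankedPositions_eq hC
    exact Or.inr ⟨c, boxNo_iff.2 h⟩

theorem exists_untilYes_or_untilNo (q : Query) : (∃ c, UntilYes q c) ∨ ∃ c, UntilNo q c := by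
  rcases exists_untilRanked_or_untilTrap (finite_gameOf q.2.1 q.1)
    (fun _ => finite_out_of_mem_gameOf) {t | t ∈ q.2.2.2.1} {t | t ∈ q.2.2.2.2.1}
    q.2.2.2.2.2 (decodeBudget q.2.1 q.2.2.1) with ⟨C, hC, h⟩ | ⟨L, hL, h⟩
  · obtain ⟨c, rfl⟩ := exists_rankedPositions_eq hC
    exact Or.inl ⟨c, untilYes_iff.2 h⟩
  · obtain ⟨c, rfl⟩ := exists_positions_eq hL
    exact Or.inr ⟨c, untilNo_iff.2 h⟩

end Checks

section Primrec

variable {α : Type*} [Primcodable α]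

theorem primrecPred_extended_le {f g : α → Option ℕ} {u v : α → ℕ} (hf : Primrec f)
    (hg : Primrec g) (hu : Primrec u) (hv : Primrec v) :
    PrimrecPred fun a => extended (f a) + u a ≤ extended (g a) + v a := by
  have h : PrimrecPred fun a => g a = none ∨
      ¬ f a = none ∧ (f a).getD 0 + u a ≤ (g a).getD 0 + v a :=
    (primrecPred_eq hg (Primrec.const _)).or
      ((primrecPred_eq hf (Primrec.const _)).not.and
        (primrecPred_le (by fun_prop) (by fun_prop)))
  refine h.of_eq fun a => ?_
  cases hg' : g a <;> cases hf' : f a <;> simp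
  all_goals norm_cast

theorem primrecPred_budgetLE {r : α → ℕ} {x y : α → List (Option ℕ)} {u v : α → List ℕ}
    (hr : Primrec r) (hx : Primrec x) (hu : Primrec u) (hy : Primrec y) (hv : Primrec v) :
    PrimrecPred fun a => BudgetLE (r a) (x a) (u a) (y a) (v a) :=
  primrecPred_forall_lt hr
    (primrecPred_extended_le (by fun_prop) (by fun_prop) (by fun_prop) (by fun_prop))

/-- What one symbol of a formula asks: the truth assignment, the symbol, and the energy game of
its coalition, where the two sets of states are the truth sets of the arguments of the symbol. -/
abbrev Problem : Type := List (ℕ × ℕ) × Token × Query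

/-- The test that `c` proves that the formula is true in the state of the query. -/
def ProvenBy (p : Problem) (c : Cert) : Prop :=
  p.2.1.1 = 0 ∧ (∃ a ∈ p.2.1.2.1, (a, p.2.2.2.2.2.2.2) ∈ p.1) ∨
  p.2.1.1 = 1 ∧ p.2.2.2.2.2.2.2 ∉ p.2.2.2.2.2.1 ∨
  p.2.1.1 = 2 ∧ (p.2.2.2.2.2.2.2 ∈ p.2.2.2.2.2.1 ∨ p.2.2.2.2.2.2.2 ∈ p.2.2.2.2.2.2.1) ∨
  p.2.1.1 = 3 ∧ NextYes p.2.2 ∨ p.2.1.1 = 4 ∧ BoxYes p.2.2 c ∨ p.2.1.1 = 5 ∧ UntilYes p.2.2 c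

/-- The test that `c` proves that the formula is false in the state of the query. Symbols of an
unknown kind count as false. -/
def RefutedBy (p : Problem) (c : Cert) : Prop :=
  p.2.1.1 = 0 ∧ (¬ ∃ a ∈ p.2.1.2.1, (a, p.2.2.2.2.2.2.2) ∈ p.1) ∨
  p.2.1.1 = 1 ∧ ¬ p.2.2.2.2.2.2.2 ∉ p.2.2.2.2.2.1 ∨
  p.2.1.1 = 2 ∧ ¬ (p.2.2.2.2.2.2.2 ∈ p.2.2.2.2.2.1 ∨ p.2.2.2.2.2.2.2 ∈ p.2.2.2.2.2.2.1) ∨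
  p.2.1.1 = 3 ∧ ¬ NextYes p.2.2 ∨ p.2.1.1 = 4 ∧ BoxNo p.2.2 c ∨ p.2.1.1 = 5 ∧ UntilNo p.2.2 c ∨
  5 < p.2.1.1

theorem primrecPred_provenBy : PrimrecPred fun x : Problem × Cert => ProvenBy x.1 x.2 := by
  unfold ProvenBy NextYes BoxYes UntilYes
  repeat' first
    | exact primrecPred_mem (by fun_prop) (by fun_prop)
    | exact primrecPred_budgetLE (by fun_prop) (by fun_prop) (by fun_prop) (by fun_prop)
        (by fun_prop)
    | exact primrecPred_eq (by fun_prop) (by fun_prop)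
    | exact primrecPred_lt (by fun_prop) (by fun_prop)
    | apply primrecPred_forall_mem (by fun_prop)
    | apply primrecPred_exists_mem (by fun_prop)
    | apply PrimrecPred.and
    | apply PrimrecPred.or
    | apply PrimrecPred.not

theorem primrecPred_refutedBy : PrimrecPred fun x : Problem × Cert => RefutedBy x.1 x.2 := by
  unfold RefutedBy NextYes BoxNo UntilNo
  repeat' first
    | exact primrecPred_mem (by fun_prop) (by fun_prop)
    | exact primrecPred_budgetLE (by fun_prop) (by fun_prop) (by fun_prop) (by fun_prop)
        (by fun_prop)
    | exact primrecPred_eq (by fun_prop) (by fun_prop)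
    | exact primrecPred_lt (by fun_prop) (by fun_prop)
    | apply primrecPred_forall_mem (by fun_prop)
    | apply primrecPred_exists_mem (by fun_prop)
    | apply PrimrecPred.and
    | apply PrimrecPred.or
    | apply PrimrecPred.not
    | apply primrecPred_imp

end Primrec

theorem exists_provenBy_or_refutedBy (p : Problem) :
    (∃ c, ProvenBy p c) ∨ ∃ c, RefutedBy p c := by
  have hle : p.2.1.1 ≤ 5 ∨ 5 < p.2.1.1 := le_or_gt _ _
  have hbox := exists_boxYes_or_boxNo p.2.2
  have huntil := exists_untilYes_or_untilNo p.2.2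
  rcases hle with h | h
  · interval_cases hk : p.2.1.1
    · by_cases h0 : ∃ a ∈ p.2.1.2.1, (a, p.2.2.2.2.2.2.2) ∈ p.1
      · exact Or.inl ⟨[], by simp [ProvenBy, hk, h0]⟩
      · exact Or.inr ⟨[], by simp only [RefutedBy, hk, h0]; simp⟩
    · by_cases h1 : p.2.2.2.2.2.2.2 ∈ p.2.2.2.2.2.1
      · exact Or.inr ⟨[], by simp [RefutedBy, hk, h1]⟩
      · exact Or.inl ⟨[], by simp [ProvenBy, hk, h1]⟩
    · by_cases h2 : p.2.2.2.2.2.2.2 ∈ p.2.2.2.2.2.1 ∨ p.2.2.2.2.2.2.2 ∈ p.2.2.2.2.2.2.1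
      · exact Or.inl ⟨[], by simp [ProvenBy, hk, h2]⟩
      · exact Or.inr ⟨[], by simp only [RefutedBy, hk, h2]; simp⟩
    · by_cases h3 : NextYes p.2.2
      · exact Or.inl ⟨[], by simp [ProvenBy, hk, h3]⟩
      · exact Or.inr ⟨[], by simp [RefutedBy, hk, h3]⟩
    · simpa [ProvenBy, RefutedBy, hk] using hbox
    · simpa [ProvenBy, RefutedBy, hk] using huntil
  · exact Or.inr ⟨[], by simp [RefutedBy, h]⟩

/-- A total computable decision of the problems. -/
theorem exists_computable_answer : ∃ answer : Problem → Bool, Computable answer ∧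
    ∀ p, (answer p = true → ∃ c, ProvenBy p c) ∧ (answer p = false → ∃ c, RefutedBy p c) :=
  exists_computable_of_certificates primrecPred_provenBy primrecPred_refutedBy
    exists_provenBy_or_refutedBy

/-! ### The moves of a coalition, computed from the code of a structure -/

/-- The cost entries of the members of the coalition `A`, for the resource `i`, when the joint
action `τ` is played in the state `s`. -/
def charges (costs : List (ℕ × ℕ × ℕ × List (ℕ × ℕ))) (A : List ℕ) (s : ℕ) (τ : List ℕ) (i : ℕ) :
    List (ℕ × ℕ) :=
  (costs.filter fun x => x.1 = s ∧ x.2.1 ∈ A ∧ τ.getD x.2.1 0 = x.2.2.1).map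
    fun x => x.2.2.2.getD i (0, 0)

/-- The targets that remain possible in the state `s` when the members of `A` act as in `τ`. -/
def targets (trans : List (ℕ × List ℕ × ℕ)) (A : List ℕ) (s : ℕ) (τ : List ℕ) : List ℕ :=
  (trans.filter fun y => y.1 = s ∧ ∀ a ∈ A, y.2.1.getD a 0 = τ.getD a 0).map fun y => y.2.2

/-- The moves of the coalition `A` in the structure coded by `c`. Each joint action of all agents
gives a move, of which only the part of `A` matters. -/
def moveCodes (c : Code) (A : List ℕ) : List MoveCode :=
  c.2.2.2.2.1.map fun x => (x.1,
    (List.range c.1.2.1).map (fun i => ((charges c.2.2.2.1 A x.1 x.2.1 i).map Prod.fst).sum),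
    (List.range c.1.2.1).map (fun i => ((charges c.2.2.2.1 A x.1 x.2.1 i).map Prod.snd).sum),
    targets c.2.2.2.2.1 A x.1 x.2.1)

@[fun_prop] theorem primrec_charges {α : Type*} [Primcodable α]
    {costs : α → List (ℕ × ℕ × ℕ × List (ℕ × ℕ))} {A : α → List ℕ} {s : α → ℕ} {τ : α → List ℕ}
    {i : α → ℕ} (hcosts : Primrec costs) (hA : Primrec A) (hs : Primrec s) (hτ : Primrec τ)
    (hi : Primrec i) : Primrec fun a => charges (costs a) (A a) (s a) (τ a) (i a) := by
  unfold charges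
  refine primrec_map (primrec_filter hcosts ?_) (by fun_prop)
  exact (primrecPred_eq (by fun_prop) (by fun_prop)).and
    ((primrecPred_mem (by fun_prop) (by fun_prop)).and (primrecPred_eq (by fun_prop) (by fun_prop)))

@[fun_prop] theorem primrec_targets {α : Type*} [Primcodable α]
    {trans : α → List (ℕ × List ℕ × ℕ)} {A : α → List ℕ} {s : α → ℕ} {τ : α → List ℕ}
    (htrans : Primrec trans) (hA : Primrec A) (hs : Primrec s) (hτ : Primrec τ) :
    Primrec fun a => targets (trans a) (A a) (s a) (τ a) := by
  unfold targets
  refine primrec_map (primrec_filter htrans ?_) (by fun_prop)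
  exact (primrecPred_eq (by fun_prop) (by fun_prop)).and
    (primrecPred_forall_mem (by fun_prop) (primrecPred_eq (by fun_prop) (by fun_prop)))

@[fun_prop] theorem primrec_moveCodes {α : Type*} [Primcodable α] {c : α → Code} {A : α → List ℕ}
    (hc : Primrec c) (hA : Primrec A) : Primrec fun a => moveCodes (c a) (A a) := by
  unfold moveCodes
  fun_prop

theorem mem_coalitionCode {n : ℕ} {A : Finset (Fin n)} {a : ℕ} :
    a ∈ coalitionCode A ↔ ∃ h : a < n, (⟨a, h⟩ : Fin n) ∈ A := by
  simp only [coalitionCode, List.mem_map, List.bind_eq_flatMap, List.pure_def, List.mem_flatMap,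
    List.mem_filter, List.mem_finRange, true_and, decide_eq_true_eq, List.mem_singleton]
  constructor
  · rintro ⟨_, ⟨b, hb, rfl⟩, rfl⟩
    exact ⟨b.2, hb⟩
  · rintro ⟨h, ha⟩
    exact ⟨_, ⟨_, ha, rfl⟩, rfl⟩

theorem decodeBudget_boundCode {r : ℕ} (b : Fin r → ℕ∞) : decodeBudget r (boundCode b) = b := by
  funext i
  simp only [decodeBudget, boundCode, List.getD_eq_getElem?_getD, List.getElem?_ofFn, i.2,
    dif_pos, Option.getD_some]
  split_ifs with h
  · simp [h]
  · simpa using ENat.natCast_toNat h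

section

variable {n r m k l : ℕ} {M : RBCGS (Fin n) (Fin r) (Fin m) (Fin k) (Fin l)}

theorem mem_valCode {p s : ℕ} : (p, s) ∈ valCode M ↔
    ∃ (hp : p < k) (hs : s < m), (⟨s, hs⟩ : Fin m) ∈ M.val ⟨p, hp⟩ := by
  simp only [valCode, List.mem_flatMap, List.mem_finRange, true_and, List.mem_filterMap,
    Option.ite_none_right_eq_some, Option.some.injEq, Prod.mk.injEq]
  constructor
  · rintro ⟨p', s', h, rfl, rfl⟩
    exact ⟨p'.2, s'.2, h⟩
  · rintro ⟨hp, hs, h⟩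
    exact ⟨_, _, h, rfl, rfl⟩

theorem mem_transCode {x : ℕ × List ℕ × ℕ} : x ∈ transCode M ↔
    ∃ (s : Fin m) (τ : (a : Fin n) → M.avail s a),
      x = ((s : ℕ), List.ofFn (fun a => ((τ a : Fin l) : ℕ)), (M.trans s τ : ℕ)) := by
  simp only [transCode, List.mem_flatMap, List.mem_finRange, true_and, List.mem_filterMap,
    Option.dite_none_right_eq_some, Option.some.injEq]
  constructor
  · rintro ⟨s, j, h, rfl⟩
    exact ⟨s, fun a => ⟨_, h a⟩, rfl⟩
  · rintro ⟨s, τ, rfl⟩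
    refine ⟨s, finFunctionFinEquiv fun a => (τ a : Fin l), ?_, ?_⟩
    · simp
    · simp

theorem getD_ofFn_val {f : Fin n → Fin l} (a : Fin n) :
    (List.ofFn fun a => (f a : ℕ)).getD a 0 = f a := by
  simp [List.getD_eq_getElem?_getD]

theorem sum_map_filterMap {α β : Type*} (L : List α) (f : α → Option β) (g : β → ℕ) :
    ((L.filterMap f).map g).sum = (L.map fun x => (f x).elim 0 g).sum := by
  induction L with
  | nil => rfl
  | cons x L ih => cases h : f x <;> simp [h, ih]

theorem sum_map_filter {α : Type*} (L : List α) (p : α → Prop) [DecidablePred p] (g : α → ℕ) :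
    ((L.filter (p ·)).map g).sum = (L.map fun x => if p x then g x else 0).sum := by
  induction L with
  | nil => rfl
  | cons x L ih => by_cases h : p x <;> simp [h, ih]

theorem sum_map_flatMap {α β : Type*} (L : List α) (f : α → List β) (g : β → ℕ) :
    ((L.flatMap f).map g).sum = (L.map fun x => ((f x).map g).sum).sum := by
  induction L with
  | nil => rfl
  | cons x L ih => simp [ih]

theorem sum_charges (A : Finset (Fin n)) (s : Fin m) (τ : (a : Fin n) → M.avail s a) (i : Fin r)
    (g : ℕ × ℕ → ℕ) :
    ((charges (costCode M) (coalitionCode A) s (List.ofFn fun a => ((τ a : Fin l) : ℕ)) i).map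
      g).sum = ∑ a ∈ A, g ((M.cost s a (τ a) i).toNat, (-(M.cost s a (τ a) i)).toNat) := by
  classical
  simp only [charges, List.map_map, sum_map_filter, costCode, sum_map_flatMap, sum_map_filterMap,
    ← Fin.sum_univ_def]
  rw [Finset.sum_eq_single s, ← Finset.sum_filter_add_sum_filter_not _ (· ∈ A),
    Finset.filter_univ_mem]
  · rw [Finset.sum_eq_zero (s := Finset.univ.filter fun a => ¬ a ∈ A), add_zero]
    · refine Finset.sum_congr rfl fun a ha => ?_
      rw [Finset.sum_eq_single (τ a : Fin l)]
      · have h1 : (a : ℕ) ∈ coalitionCode A := mem_coalitionCode.2 ⟨a.2, ha⟩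
        have h2 : (τ a : Fin l) ∈ M.avail s a := (τ a).2
        simp [h1, List.getD_eq_getElem?_getD]
      · intro α _ hα
        by_cases h : α ∈ M.avail s a
        · have : ¬ ((τ a : Fin l) : ℕ) = α := fun h' => hα (Fin.ext h'.symm)
          simp [h, List.getD_eq_getElem?_getD, this]
        · simp [h]
      · simp
    · intro a ha
      have h1 : ¬ (a : ℕ) ∈ coalitionCode A := by
        rw [mem_coalitionCode]
        rintro ⟨_, h⟩
        exact (Finset.mem_filter.1 ha).2 h
      refine Finset.sum_eq_zero fun α _ => ?_
      by_cases h : α ∈ M.avail s a <;> simp [h, h1]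
  · intro s' _ hs'
    have h1 : ¬ (s' : ℕ) = s := fun h => hs' (Fin.ext h)
    refine Finset.sum_eq_zero fun a _ => Finset.sum_eq_zero fun α _ => ?_
    by_cases h : α ∈ M.avail s' a <;> simp [h, h1]
  · simp

theorem mem_targets_iff (A : Finset (Fin n)) (s : Fin m) (τ : (a : Fin n) → M.avail s a) (t : ℕ) :
    t ∈ targets (transCode M) (coalitionCode A) s (List.ofFn fun a => ((τ a : Fin l) : ℕ)) ↔
      t ∈ Fin.val '' M.outcomes s (A := A) fun a => τ a := by
  simp only [targets, List.mem_map, List.mem_filter, mem_transCode, decide_eq_true_eq]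
  constructor
  · rintro ⟨_, ⟨⟨s', τ', rfl⟩, hs, hA⟩, rfl⟩
    obtain rfl := Fin.ext hs
    refine ⟨_, ⟨τ', fun a => Subtype.ext ?_, rfl⟩, rfl⟩
    have := hA a (mem_coalitionCode.2 ⟨a.1.2, a.2⟩)
    rw [getD_ofFn_val, getD_ofFn_val] at this
    exact Fin.ext this
  · rintro ⟨_, ⟨τ', hA, rfl⟩, rfl⟩
    refine ⟨_, ⟨⟨s, τ', rfl⟩, rfl, fun a ha => ?_⟩, rfl⟩
    obtain ⟨h, ha⟩ := mem_coalitionCode.1 ha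
    have := hA ⟨⟨a, h⟩, ha⟩
    have h1 := getD_ofFn_val (f := fun a => (τ' a : Fin l)) ⟨a, h⟩
    have h2 := getD_ofFn_val (f := fun a => (τ a : Fin l)) ⟨a, h⟩
    simp only at h1 h2 this
    rw [h1, h2, this]

end

theorem gameOf_moveCodes (I : Instance) (A : Finset (Fin I.numAgt)) :
    gameOf I.numRes (moveCodes I.code (coalitionCode A)) = I.model.arena A Fin.val := by
  have key : ∀ (s : Fin I.numState) (τ : (a : Fin I.numAgt) → I.model.avail s a)
      (x : ℕ × List ℕ × ℕ),
      x = ((s : ℕ), List.ofFn (fun a => ((τ a : Fin I.numAct) : ℕ)), (I.model.trans s τ : ℕ)) →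
      decodeMove I.numRes (x.1,
        (List.range I.numRes).map (fun i => ((charges (costCode I.model) (coalitionCode A) x.1 x.2.1
          i).map Prod.fst).sum),
        (List.range I.numRes).map (fun i => ((charges (costCode I.model) (coalitionCode A) x.1 x.2.1
          i).map Prod.snd).sum),
        targets (transCode I.model) (coalitionCode A) x.1 x.2.1) =
      ⟨s, I.model.jointCost s (A := A) fun a => τ a,
        Fin.val '' I.model.outcomes s (A := A) fun a => τ a⟩ := by
    rintro s τ _ rfl
    ext1
    · rfl
    · funext i
      simp only [decodeMove, RBCGS.jointCost, Finset.sum_apply, List.getD_eq_getElem?_getD,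
        List.getElem?_map, List.getElem?_range i.2, Option.map_some, Option.getD_some, sum_charges]
      rw [Finset.sum_coe_sort A (fun a => I.model.cost s a (τ a) i)]
      push_cast
      rw [← Finset.sum_sub_distrib]
      refine Finset.sum_congr rfl fun a _ => ?_
      omega
    · ext t
      exact mem_targets_iff A s τ t
  ext mv
  constructor
  · rintro ⟨c, hc, rfl⟩
    obtain ⟨x, hx, rfl⟩ := List.mem_map.1 hc
    obtain ⟨s, τ, hx⟩ := mem_transCode.1 hx
    exact ⟨s, _, key s τ x hx⟩
  · rintro ⟨s, σ, rfl⟩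
    -- The other agents idle in a joint action that extends `σ`.
    classical
    let τ : (a : Fin I.numAgt) → I.model.avail s a := fun a =>
      if h : a ∈ A then σ ⟨a, h⟩ else ⟨I.model.idle, I.model.idle_mem s a⟩
    have hτ : (fun a : A => τ a) = σ := funext fun a => dif_pos a.2
    rw [← hτ]
    exact ⟨_, List.mem_map.2 ⟨_, mem_transCode.2 ⟨s, τ, rfl⟩, rfl⟩, key s τ _ rfl⟩

/-! ### Evaluation of formulas -/

/-- The number of arguments of a symbol of kind `k`. -/
def arity (k : ℕ) : ℕ := if k = 0 then 0 else if k = 2 ∨ k = 5 then 2 else 1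

/-- The question whether the formula with the outermost symbol `tok` is true in the state `s`,
where `st` starts with the truth sets of its arguments. -/
def problemOf (c : Code) (tok : Token) (st : List (List ℕ)) (s : ℕ) : Problem :=
  (c.2.1, tok, moveCodes c tok.2.1, c.1.2.1, tok.2.2, st.headI, st.tail.headI, s)

/-- The states in which the formula with the outermost symbol `tok` is true. -/
def truthSet (answer : Problem → Bool) (c : Code) (tok : Token) (st : List (List ℕ)) : List ℕ :=
  (List.range c.1.2.2.1).filter fun s => answer (problemOf c tok st s)

/-- Evaluation of a formula in prefix notation from right to left, on a stack of truth sets. -/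
def evaluate (answer : Problem → Bool) (c : Code) (toks : List Token) : List (List ℕ) :=
  toks.foldr (fun tok st => truthSet answer c tok st :: st.drop (arity tok.1)) []

theorem evaluate_cons (answer : Problem → Bool) (c : Code) (tok : Token) (toks : List Token) :
    evaluate answer c (tok :: toks) = truthSet answer c tok (evaluate answer c toks) ::
      (evaluate answer c toks).drop (arity tok.1) := rfl

theorem primrec_problemOf {α : Type*} [Primcodable α] {c : α → Code} {tok : α → Token}
    {st : α → List (List ℕ)} {s : α → ℕ} (hc : Primrec c) (htok : Primrec tok) (hst : Primrec st)
    (hs : Primrec s) : Primrec fun a => problemOf (c a) (tok a) (st a) (s a) := by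
  have hA : Primrec fun a => (tok a).2.1 := Primrec.fst.comp (Primrec.snd.comp htok)
  have hr : Primrec fun a => (c a).1.2.1 :=
    Primrec.fst.comp (Primrec.snd.comp (Primrec.fst.comp hc))
  exact (Primrec.fst.comp (Primrec.snd.comp hc)).pair (htok.pair ((primrec_moveCodes hc hA).pair
    (hr.pair ((Primrec.snd.comp (Primrec.snd.comp htok)).pair ((Primrec.list_headI.comp hst).pair
      ((Primrec.list_headI.comp (Primrec.list_tail.comp hst)).pair hs))))))

theorem primrec_arity : Primrec arity :=
  Primrec.ite (primrecPred_eq Primrec.id (Primrec.const 0)) (Primrec.const 0)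
    (Primrec.ite ((primrecPred_eq Primrec.id (Primrec.const 2)).or
      (primrecPred_eq Primrec.id (Primrec.const 5))) (Primrec.const 2) (Primrec.const 1))

theorem computable_evaluate {answer : Problem → Bool} (h : Computable answer) :
    Computable fun c : Code => evaluate answer c c.2.2.2.2.2.2 := by
  have hproblem : Primrec fun x : ((Code × Token) × List (List ℕ)) × ℕ =>
      problemOf x.1.1.1 x.1.1.2 x.1.2 x.2 :=
    primrec_problemOf (Primrec.fst.comp (Primrec.fst.comp Primrec.fst))
      (Primrec.snd.comp (Primrec.fst.comp Primrec.fst)) (Primrec.snd.comp Primrec.fst) Primrec.snd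
  have hrange : Primrec fun x : (Code × Token) × List (List ℕ) => x.1.1.1.2.2.1 :=
    Primrec.fst.comp (Primrec.snd.comp (Primrec.snd.comp (Primrec.fst.comp
      (Primrec.fst.comp Primrec.fst))))
  have hdrop : Primrec fun x : (Code × Token) × List (List ℕ) => x.2.drop (arity x.1.2.1) :=
    Primrec.list_drop.comp (primrec_arity.comp (Primrec.fst.comp (Primrec.snd.comp Primrec.fst)))
      Primrec.snd
  have htoks : Primrec fun c : Code => c.2.2.2.2.2.2 :=
    Primrec.snd.comp (Primrec.snd.comp (Primrec.snd.comp (Primrec.snd.comp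
      (Primrec.snd.comp Primrec.snd))))
  exact computable_foldr htoks.to_comp (Computable.const []) (Computable.list_cons.comp
    (computable_filter_range hrange.to_comp (h.comp hproblem.to_comp)) hdrop.to_comp)

theorem computable_decide_mem {α : Type*} [Primcodable α] {f : α → ℕ} {g : α → List (List ℕ)}
    (hf : Computable f) (hg : Computable g) : Computable fun a => decide (f a ∈ (g a).headI) := by
  have hmem : Primrec fun x : ℕ × List (List ℕ) => decide (x.1 ∈ x.2.headI) :=
    (primrecPred_mem (Primrec.list_headI.comp Primrec.snd) Primrec.fst).decide
  exact hmem.to_comp.comp (hf.pair hg)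

theorem answer_iff {answer : Problem → Bool}
    (h : ∀ p, (answer p = true → ∃ c, ProvenBy p c) ∧ (answer p = false → ∃ c, RefutedBy p c))
    {p : Problem} {Q : Prop} (hyes : ∀ c, ProvenBy p c → Q) (hno : ∀ c, RefutedBy p c → ¬ Q) :
    answer p = true ↔ Q := by
  cases hp : answer p
  · obtain ⟨c, hc⟩ := (h p).2 hp
    simpa using hno c hc
  · obtain ⟨c, hc⟩ := (h p).1 hp
    simpa using hyes c hc

section

variable {I : Instance} {A : Finset (Fin I.numAgt)} {b : Fin I.numRes → ℕ∞}
  {φ ψ : Formula (Fin I.numAgt) (Fin I.numRes) (Fin I.numPrp)} {X Y : List ℕ}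
  {s : Fin I.numState} {c : Cert}

/-- The list `X` is the truth set of `φ`. -/
def IsTruthSet (I : Instance) (φ : Formula (Fin I.numAgt) (Fin I.numRes) (Fin I.numPrp))
    (X : List ℕ) : Prop :=
  ∀ s : Fin I.numState, (s : ℕ) ∈ X ↔ I.model.Sat φ s

/-- The energy game behind a formula with the coalition `A` and the bound `b`. -/
noncomputable def queryOf (I : Instance) (A : Finset (Fin I.numAgt)) (b : Fin I.numRes → ℕ∞) (X Y : List ℕ)
    (s : Fin I.numState) : Query :=
  (moveCodes I.code (coalitionCode A), I.numRes, boundCode b, X, Y, (s : ℕ))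

theorem nextYes_queryOf_iff (hX : IsTruthSet I φ X) :
    NextYes (queryOf I A b X Y s) ↔ I.model.Sat (.coalNext A b φ) s := by
  refine nextYes_iff.trans ?_
  simp only [queryOf, gameOf_moveCodes, decodeBudget_boundCode]
  refine (RBCGS.exists_next_iff Fin.val_injective).symm.trans ?_
  simp only [RBCGS.Sat, Set.mem_ofPred_eq, hX _]

theorem sat_coalBox_of_boxYes (hX : IsTruthSet I φ X) (h : BoxYes (queryOf I A b X Y s) c) :
    I.model.Sat (.coalBox A b φ) s := by
  rw [boxYes_iff] at h
  simp only [queryOf, gameOf_moveCodes, decodeBudget_boundCode] at h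
  obtain ⟨hV, e, he, hs⟩ := h
  obtain ⟨F, hF, h⟩ := RBCGS.exists_box_of_boxClosed Fin.val_injective hV he hs
  exact ⟨F, hF, fun w hw i => (hX _).1 (h w hw i)⟩

theorem not_sat_coalBox_of_boxNo (hX : IsTruthSet I φ X) (h : BoxNo (queryOf I A b X Y s) c) :
    ¬ I.model.Sat (.coalBox A b φ) s := by
  rw [boxNo_iff] at h
  simp only [queryOf, gameOf_moveCodes, decodeBudget_boundCode] at h
  obtain ⟨hC, k, e, he, hs⟩ := h
  rintro ⟨F, hF, h⟩
  exact RBCGS.not_exists_box_of_boxRefuted hC he hs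
    ⟨F, hF, fun w hw i => (hX _).2 (h w hw i)⟩

theorem sat_coalUntil_of_untilYes (hX : IsTruthSet I φ X) (hY : IsTruthSet I ψ Y)
    (h : UntilYes (queryOf I A b X Y s) c) : I.model.Sat (.coalUntil A b φ ψ) s := by
  rw [untilYes_iff] at h
  simp only [queryOf, gameOf_moveCodes, decodeBudget_boundCode] at h
  obtain ⟨hC, k, e, he, hs⟩ := h
  obtain ⟨F, hF, h⟩ := RBCGS.exists_until_of_untilRanked Fin.val_injective hC he hs
  refine ⟨F, hF, fun w hw => ?_⟩
  obtain ⟨i, hi, hj⟩ := h w hw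
  exact ⟨i, (hY _).1 hi, fun j hji => (hX _).1 (hj j hji)⟩

theorem not_sat_coalUntil_of_untilNo (hX : IsTruthSet I φ X) (hY : IsTruthSet I ψ Y)
    (h : UntilNo (queryOf I A b X Y s) c) : ¬ I.model.Sat (.coalUntil A b φ ψ) s := by
  rw [untilNo_iff] at h
  simp only [queryOf, gameOf_moveCodes, decodeBudget_boundCode] at h
  obtain ⟨hL, e, he, hs⟩ := h
  rintro ⟨F, hF, h⟩
  refine RBCGS.not_exists_until_of_untilTrap hL he hs ⟨F, hF, fun w hw => ?_⟩
  obtain ⟨i, hi, hj⟩ := h w hw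
  exact ⟨i, (hY _).2 hi, fun j hji => (hX _).2 (hj j hji)⟩

end

theorem isTruthSet_truthSet {answer : Problem → Bool} {I : Instance}
    {φ : Formula (Fin I.numAgt) (Fin I.numRes) (Fin I.numPrp)} {tok : Token}
    {st : List (List ℕ)}
    (h : ∀ s : Fin I.numState, answer (problemOf I.code tok st s) = true ↔ I.model.Sat φ s) :
    IsTruthSet I φ (truthSet answer I.code tok st) := by
  intro s
  have hs : (s : ℕ) < I.code.1.2.2.1 := s.2
  simp [truthSet, h, hs]

theorem isTruthSet_atom {answer : Problem → Bool}
    (h : ∀ p, (answer p = true → ∃ c, ProvenBy p c) ∧ (answer p = false → ∃ c, RefutedBy p c))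
    (I : Instance) (p : Fin I.numPrp) (st : List (List ℕ)) :
    IsTruthSet I (.atom p) (truthSet answer I.code (0, [(p : ℕ)], []) st) := by
  refine isTruthSet_truthSet fun s => ?_
  have hval : I.model.Sat (.atom p) s ↔ ((p : ℕ), (s : ℕ)) ∈ I.code.2.1 := by
    refine Iff.trans ?_ mem_valCode.symm
    rw [RBCGS.Sat]
    exact ⟨fun h => ⟨p.2, s.2, h⟩, fun ⟨_, _, h⟩ => h⟩
  rw [hval]
  refine answer_iff h (fun c hc => ?_) fun c hc => ?_
  · simpa [ProvenBy, problemOf] using hc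
  · simpa [RefutedBy, problemOf] using hc

/-- Evaluating the prefix notation of a formula pushes its truth set on the stack. -/
theorem evaluate_code_append {answer : Problem → Bool}
    (h : ∀ p, (answer p = true → ∃ c, ProvenBy p c) ∧ (answer p = false → ∃ c, RefutedBy p c))
    (I : Instance) (φ : Formula (Fin I.numAgt) (Fin I.numRes) (Fin I.numPrp))
    (toks : List Token) : ∃ X, IsTruthSet I φ X ∧
      evaluate answer I.code (φ.code ++ toks) = X :: evaluate answer I.code toks := by
  induction φ generalizing toks with
  | atom p => exact ⟨_, isTruthSet_atom h I p _, rfl⟩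
  | neg φ ih =>
    obtain ⟨X, hX, hev⟩ := ih toks
    rw [Formula.code, List.cons_append, evaluate_cons, hev]
    refine ⟨_, isTruthSet_truthSet fun s => ?_, rfl⟩
    rw [RBCGS.Sat, ← hX]
    refine answer_iff h (fun c hc => ?_) fun c hc => ?_
    · simpa [ProvenBy, problemOf] using hc
    · simpa [RefutedBy, problemOf] using hc
  | disj φ ψ ihφ ihψ =>
    obtain ⟨Y, hY, hevY⟩ := ihψ toks
    obtain ⟨X, hX, hevX⟩ := ihφ (ψ.code ++ toks)
    rw [Formula.code, List.cons_append, List.append_assoc, evaluate_cons, hevX, hevY]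
    refine ⟨_, isTruthSet_truthSet fun s => ?_, rfl⟩
    rw [RBCGS.Sat, ← hX, ← hY]
    refine answer_iff h (fun c hc => ?_) fun c hc => ?_
    · simpa [ProvenBy, problemOf] using hc
    · simpa [RefutedBy, problemOf] using hc
  | coalNext A b φ ih =>
    obtain ⟨X, hX, hev⟩ := ih toks
    rw [Formula.code, List.cons_append, evaluate_cons, hev]
    refine ⟨_, isTruthSet_truthSet fun s => ?_, rfl⟩
    refine answer_iff h (fun c hc => ?_) fun c hc => ?_
    · simp [ProvenBy, problemOf] at hc
      exact (nextYes_queryOf_iff hX).1 hc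
    · rw [← nextYes_queryOf_iff hX (Y := (evaluate answer I.code toks).headI)]
      simp [RefutedBy, problemOf] at hc
      exact hc
  | coalBox A b φ ih =>
    obtain ⟨X, hX, hev⟩ := ih toks
    rw [Formula.code, List.cons_append, evaluate_cons, hev]
    refine ⟨_, isTruthSet_truthSet fun s => ?_, rfl⟩
    refine answer_iff h (fun c hc => ?_) fun c hc => ?_
    · simp [ProvenBy, problemOf] at hc
      exact sat_coalBox_of_boxYes hX hc
    · simp [RefutedBy, problemOf] at hc
      exact not_sat_coalBox_of_boxNo hX hc
  | coalUntil A b φ ψ ihφ ihψ =>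
    obtain ⟨Y, hY, hevY⟩ := ihψ toks
    obtain ⟨X, hX, hevX⟩ := ihφ (ψ.code ++ toks)
    rw [Formula.code, List.cons_append, List.append_assoc, evaluate_cons, hevX, hevY]
    refine ⟨_, isTruthSet_truthSet fun s => ?_, rfl⟩
    refine answer_iff h (fun c hc => ?_) fun c hc => ?_
    · simp [ProvenBy, problemOf] at hc
      exact sat_coalUntil_of_untilYes hX hY hc
    · simp [RefutedBy, problemOf] at hc
      exact not_sat_coalUntil_of_untilNo hX hY hc

end RBATL

theorem mainTheorem1 :
    ∃ decider : RBATL.Code → Bool, Computable decider ∧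
      ∀ I : RBATL.Instance, decider I.code = true ↔ I.Holds := by
  obtain ⟨answer, hcomp, h⟩ := RBATL.exists_computable_answer
  refine ⟨fun c => decide (c.2.2.2.2.2.1 ∈ (RBATL.evaluate answer c c.2.2.2.2.2.2).headI), ?_,
    fun I => ?_⟩
  · have hs : Primrec fun c : RBATL.Code => c.2.2.2.2.2.1 :=
      Primrec.fst.comp (Primrec.snd.comp (Primrec.snd.comp (Primrec.snd.comp
        (Primrec.snd.comp Primrec.snd))))
    exact RBATL.computable_decide_mem hs.to_comp (RBATL.computable_evaluate hcomp)
  · obtain ⟨X, hX, hev⟩ := RBATL.evaluate_code_append h I I.formula []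
    rw [List.append_nil] at hev
    have hev' : RBATL.evaluate answer I.code I.code.2.2.2.2.2.2 = _ := hev
    rw [decide_eq_true_eq, hev']
    exact hX I.state
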